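/- Let $G\rightrightarrows M$ be a Lie groupoid with source $s$, target $t$ and units $1_y$ ($y\in M$), where $G$ and $M$ are smooth, Hausdorff, second countable manifolds and $n=\dim M$. For an open $U\subset M$ write $G_U=s^{-1}(U)\cap t^{-1}(U)$ for the arrows of the restriction $G_U\rightrightarrows U$. Let $x\in M$ be a fixed point (the orbit of $x$ is $\{x\}$), and suppose that $G$ is proper at $x$: every sequence $(g_i)$ in $G$ with $(t(g_i),s(g_i))\to(x,x)$ in $M\times M$ has a convergent subsequence. Let $G_x=s^{-1}(x)\cap t^{-1}(x)$ be the isotropy group at $x$; it is a Lie group, embedded in $G$ as a submanifold. Then there is an open neighbourhood $W$ of $x$ such that every neighbourhood of $x$ contains an open $U\ni x$ with the following properties: 1. $U\subset W$ and $U$ is saturated in the restricted groupoid $G_W\rightrightarrows W$, that is, every arrow of $G$ with source in $U$ and target in $W$ has its target in $U$; 2. there are a diffeomorphism $\psi:U\to\mathbb{R}^n$ and a diffeomorphism $\Phi:G_U\to G_x\times\mathbb{R}^n$ such that $\Phi(g)=(g,0)$ for all $g\in G_x$, $\operatorname{pr}_2(\Phi(g))=\psi(s(g))$ for all $g\in G_U$,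 and $\Phi(1_y)=(1,\psi(y))$ for all $y\in U$. So, identifying $U$ with $\mathbb{R}^n$ by $\psi$, the source becomes the projection $G_x\times\mathbb{R}^n\to\mathbb{R}^n$ and the units become $1\times\mathbb{R}^n$. -/

import Mathlib

open scoped Manifold ContDiff Topology

/-- A map `f : X → Y` is proper at the point `y`: every sequence in `X` whose image converges to `y`
has a convergent subsequence. -/
def ProperAtPoint {X Y : Type*} [TopologicalSpace X] [TopologicalSpace Y] (f : X → Y) (y : Y) :
    Prop :=
  ∀ a : ℕ → X, Filter.Tendsto (fun i => f (a i)) Filter.atTop (𝓝 y) →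
    ∃ (b : X) (φ : ℕ → ℕ), StrictMono φ ∧ Filter.Tendsto (fun i => a (φ i)) Filter.atTop (𝓝 b)

/-- A Lie groupoid `G ⇉ M`, where `M` is an `n`-dimensional and `G` an `m`-dimensional smooth
manifold. The arrow `g` goes from `source g` to `target g`, and `mul g h _` is the composite `g h`,
defined when `source g = target h`. -/
structure LieGroupoid (n m : ℕ)
    (M : Type*) [TopologicalSpace M] [ChartedSpace (EuclideanSpace ℝ (Fin n)) M]
    (G : Type*) [TopologicalSpace G] [ChartedSpace (EuclideanSpace ℝ (Fin m)) G] where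
  source : G → M
  target : G → M
  unit : M → G
  inv : G → G
  mul : ∀ g h : G, source g = target h → G
  source_submersion : Manifold.IsSubmersion (𝓡 m) (𝓡 n) ∞ source
  target_submersion : Manifold.IsSubmersion (𝓡 m) (𝓡 n) ∞ target
  unit_smooth : ContMDiff (𝓡 n) (𝓡 m) ∞ unit
  inv_smooth : ContMDiff (𝓡 m) (𝓡 m) ∞ inv
  /-- The multiplication is smooth on the submanifold `{(g, h) | source g = target h}` of `G × G`:
  around each of its points it extends to a smooth map on an open subset of `G × G`. -/
  mul_smooth : ∀ p : G × G, source p.1 = target p.2 →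
    ∃ (O : Set (G × G)) (f : G × G → G), IsOpen O ∧ p ∈ O ∧
      ContMDiffOn ((𝓡 m).prod (𝓡 m)) (𝓡 m) ∞ f O ∧
      ∀ q ∈ O, ∀ hq : source q.1 = target q.2, f q = mul q.1 q.2 hq
  source_mul : ∀ g h (e : source g = target h), source (mul g h e) = source h
  target_mul : ∀ g h (e : source g = target h), target (mul g h e) = target g
  mul_assoc : ∀ g h k (e₁ : source g = target h) (e₂ : source h = target k),
    mul (mul g h e₁) k ((source_mul g h e₁).trans e₂) =
      mul g (mul h k e₂) (e₁.trans (target_mul h k e₂).symm)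
  source_unit : ∀ x, source (unit x) = x
  target_unit : ∀ x, target (unit x) = x
  mul_unit : ∀ g, mul g (unit (source g)) (target_unit (source g)).symm = g
  unit_mul : ∀ g, mul (unit (target g)) g (source_unit (target g)) = g
  source_inv : ∀ g, source (inv g) = target g
  target_inv : ∀ g, target (inv g) = source g
  mul_inv : ∀ g, mul g (inv g) (target_inv g).symm = unit (target g)
  inv_mul : ∀ g, mul (inv g) g (source_inv g) = unit (source g)

namespace LieGroupoid

variable {n m : ℕ}
  {M : Type*} [TopologicalSpace M] [ChartedSpace (EuclideanSpace ℝ (Fin n)) M]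
  {G : Type*} [TopologicalSpace G] [ChartedSpace (EuclideanSpace ℝ (Fin m)) G]
  (𝒢 : LieGroupoid n m M G)

/-- The orbit of `x`. -/
def orbit (x : M) : Set M := {y | ∃ g, 𝒢.source g = x ∧ 𝒢.target g = y}

/-- `x` is a fixed point if its orbit is reduced to `x`. -/
def IsFixedPoint (x : M) : Prop := 𝒢.orbit x = {x}

/-- The anchor map `ρ = (t, s)`. -/
def anchor (g : G) : M × M := (𝒢.target g, 𝒢.source g)

/-- The Lie groupoid is proper at `x` if its anchor is proper at `(x, x)`. -/
def IsProperAt (x : M) : Prop := ProperAtPoint 𝒢.anchor (x, x)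

/-- The isotropy group `G_x` of arrows from `x` to `x`, with the topology induced by `G`. -/
def Isotropy (x : M) : Type _ := {g : G // 𝒢.source g = x ∧ 𝒢.target g = x}

instance (x : M) : TopologicalSpace (𝒢.Isotropy x) :=
  inferInstanceAs (TopologicalSpace {g : G // 𝒢.source g = x ∧ 𝒢.target g = x})

/-- The inclusion `G_x → G`. -/
def isotropyIncl (x : M) (g : 𝒢.Isotropy x) : G := g.1

/-- The group structure of `G_x` given by composition of arrows. -/
instance (x : M) : Group (𝒢.Isotropy x) where
  mul g h := ⟨𝒢.mul g.1 h.1 (g.2.1.trans h.2.2.symm),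
    (𝒢.source_mul _ _ _).trans h.2.1, (𝒢.target_mul _ _ _).trans g.2.2⟩
  one := ⟨𝒢.unit x, 𝒢.source_unit x, 𝒢.target_unit x⟩
  inv g := ⟨𝒢.inv g.1, (𝒢.source_inv _).trans g.2.2, (𝒢.target_inv _).trans g.2.1⟩
  mul_assoc g h k := Subtype.ext (𝒢.mul_assoc g.1 h.1 k.1 _ _)
  one_mul := by
    rintro ⟨g, hs, rfl⟩
    exact Subtype.ext (𝒢.unit_mul g)
  mul_one := by
    rintro ⟨g, rfl, ht⟩
    exact Subtype.ext (𝒢.mul_unit g)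
  inv_mul_cancel := by
    rintro ⟨g, rfl, ht⟩
    exact Subtype.ext (𝒢.inv_mul g)

/-- The arrows `G_U = s⁻¹(U) ∩ t⁻¹(U)` of the restriction of `G` to an open subset `U` of `M`, an
open subset (hence an open submanifold) of `G`. -/
def restrict (U : TopologicalSpace.Opens M) : TopologicalSpace.Opens G :=
  ⟨𝒢.source ⁻¹' U ∩ 𝒢.target ⁻¹' U,
    (U.isOpen.preimage 𝒢.source_submersion.contMDiff.continuous).inter
      (U.isOpen.preimage 𝒢.target_submersion.contMDiff.continuous)⟩

/-- The source map `G_U → U`. -/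
def restrictSource (U : TopologicalSpace.Opens M) (g : 𝒢.restrict U) : U :=
  ⟨𝒢.source g, g.2.1⟩

/-- The unit map `U → G_U`. -/
def restrictUnit (U : TopologicalSpace.Opens M) (y : U) : 𝒢.restrict U :=
  ⟨𝒢.unit y, Set.mem_preimage.mpr (by rw [𝒢.source_unit]; exact y.2),
    Set.mem_preimage.mpr (by rw [𝒢.target_unit]; exact y.2)⟩

/-- The inclusion `G_x → G_U` for a point `x` of `U`. -/
def isotropyToRestrict (U : TopologicalSpace.Opens M) {x : M} (hx : x ∈ U) (g : 𝒢.Isotropy x) :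
    𝒢.restrict U :=
  ⟨g.1, Set.mem_preimage.mpr (by rw [g.2.1]; exact hx),
    Set.mem_preimage.mpr (by rw [g.2.2]; exact hx)⟩

/-- `U` is a saturated subset of the restriction `G_W ⇉ W`: it is contained in `W`, and every arrow
of `G_W` whose source lies in `U` has its target in `U`. -/
def IsSaturatedIn (U W : Set M) : Prop :=
  U ⊆ W ∧ ∀ g : G, 𝒢.source g ∈ U → 𝒢.target g ∈ W → 𝒢.target g ∈ U

end LieGroupoid

/-!
Let `K = G_x`, which is compact by properness. In slice charts adapted to `K` there are local smooth
retractions of `G` onto `K`; two retractions `r₀`, `r₁` are interpolated by `r₀ · m (χ, r₀⁻¹ r₁)`,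
where `m` contracts a neighbourhood of `1` in the group `K` to `1` and `χ` is a cut-off function, so
that a smooth retraction `r` exists near all of `K`, and it can be normalised to be `1` on units.
Then `(r, s)` identifies a neighbourhood of `K` in `G` with one of `K × {0}` in `K × ℝⁿ`.

The set of points `z` near `0` all of whose arrows `(h, z)` have target of norm `< ρ` is saturated:
by properness, all arrows between points near `x` lie in this neighbourhood of `K`. It remains to
see that the set is diffeomorphic to `ℝⁿ`. Near `K × {0}`, the target `T (h, z)` vanishes at `z = 0`
and its norm is comparable to `‖z‖`, since inversion exchanges source and target; as the radial
derivative of `T` at `(h, z)` is `T (h, z) + o(‖z‖)`, the function `‖T‖` does not decrease along the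
rays `l ↦ (h, l z)`. Hence the set is open and star-shaped, and it is stretched along the rays onto
`ℝⁿ`.
-/

noncomputable section LocalDiffeomorphisms

open Filter Set TopologicalSpace

section

variable {E₁ E₂ H₁ H₂ M₁ M₂ : Type*} [NormedAddCommGroup E₁] [NormedSpace ℝ E₁]
  [TopologicalSpace H₁] {I : ModelWithCorners ℝ E₁ H₁} [TopologicalSpace M₁] [ChartedSpace H₁ M₁]
  [NormedAddCommGroup E₂] [NormedSpace ℝ E₂]
  [TopologicalSpace H₂] {J : ModelWithCorners ℝ E₂ H₂} [TopologicalSpace M₂] [ChartedSpace H₂ M₂]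
  {f g : M₁ → M₂} {x : M₁}

/-- The restriction of a partial diffeomorphism to an open subset of its domain. -/
def restrictPartialDiffeomorph (Φ : PartialDiffeomorph I J M₁ M₂ ∞) (O : Set M₁) (hO : IsOpen O) :
    PartialDiffeomorph I J M₁ M₂ ∞ where
  toPartialEquiv := (Φ.toOpenPartialHomeomorph.restrOpen O hO).toPartialEquiv
  open_source := (Φ.toOpenPartialHomeomorph.restrOpen O hO).open_source
  open_target := (Φ.toOpenPartialHomeomorph.restrOpen O hO).open_target
  contMDiffOn_toFun := Φ.contMDiffOn_toFun.mono fun _ hy => hy.1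
  contMDiffOn_invFun := Φ.contMDiffOn_invFun.mono fun _ hy => hy.1

theorem isLocalDiffeomorphAt_congr (hf : IsLocalDiffeomorphAt I J ∞ f x) (h : g =ᶠ[𝓝 x] f) :
    IsLocalDiffeomorphAt I J ∞ g x := by
  obtain ⟨Φ, hx, hΦ⟩ := hf
  obtain ⟨O, hO, hOo, hxO⟩ := eventually_nhds_iff.1 h
  exact ⟨restrictPartialDiffeomorph Φ O hOo, ⟨hx, hxO⟩,
    fun y hy => (hO y hy.2).trans (hΦ hy.1)⟩

theorem isLocalDiffeomorphAt_id (x : M₁) : IsLocalDiffeomorphAt I I ∞ (id : M₁ → M₁) x :=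
  (Diffeomorph.refl I M₁ ∞).isLocalDiffeomorph x

theorem isOpen_setOf_isLocalDiffeomorphAt (f : M₁ → M₂) :
    IsOpen {x | IsLocalDiffeomorphAt I J ∞ f x} := by
  refine isOpen_iff_mem_nhds.2 ?_
  rintro x ⟨Φ, hx, hΦ⟩
  filter_upwards [Φ.open_source.mem_nhds hx] with y hy
  exact ⟨Φ, hy, hΦ⟩

/-- The partial diffeomorphism defined by an injective local diffeomorphism on an open set. -/
def partialDiffeomorphOfInjOn [Nonempty M₁] {V : Set M₁} (hV : IsOpen V)
    (hf : ∀ y ∈ V, IsLocalDiffeomorphAt I J ∞ f y) (hinj : InjOn f V) :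
    PartialDiffeomorph I J M₁ M₂ ∞ where
  toPartialEquiv := hinj.toPartialEquiv
  open_source := hV
  open_target := by
    refine isOpen_iff_mem_nhds.2 ?_
    rintro _ ⟨y, hy, rfl⟩
    have hloc : IsLocalHomeomorphOn f V :=
      IsLocalDiffeomorphOn.isLocalHomeomorphOn fun y => hf y y.2
    rw [← hloc.map_nhds_eq hy]
    exact image_mem_map (hV.mem_nhds hy)
  contMDiffOn_toFun y hy := (hf y hy).contMDiffAt.contMDiffWithinAt
  contMDiffOn_invFun := by
    rintro _ ⟨y, hy, rfl⟩
    obtain ⟨Φ, hyΦ, hΦ⟩ := hf y hy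
    have hfy : f y ∈ Φ.target := hΦ hyΦ ▸ Φ.map_source hyΦ
    have hsymm : Φ.symm (f y) = y := hΦ hyΦ ▸ Φ.left_inv hyΦ
    have hsmooth : ContMDiffAt J I ∞ Φ.symm (f y) :=
      Φ.contMDiffOn_invFun.contMDiffAt (Φ.open_target.mem_nhds hfy)
    refine (hsmooth.congr_of_eventuallyEq ?_).contMDiffWithinAt
    filter_upwards [Φ.open_target.mem_nhds hfy,
      hsmooth.continuousAt (hV.mem_nhds (hsymm.symm ▸ hy))] with q hq hqV
    have hfq : f (Φ.symm q) = q := (hΦ (Φ.map_target hq)).trans (Φ.right_inv hq)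
    calc Function.invFunOn f V q = Function.invFunOn f V (f (Φ.symm q)) := by rw [hfq]
      _ = Φ.symm q := hinj.leftInvOn_invFunOn hqV

theorem exists_partialDiffeomorph_of_isCompact [T2Space M₂] [Nonempty M₁] {S : Set M₁}
    (hS : IsCompact S) (hf : ∀ y ∈ S, IsLocalDiffeomorphAt I J ∞ f y) (hinj : InjOn f S) :
    ∃ Φ : PartialDiffeomorph I J M₁ M₂ ∞, S ⊆ Φ.source ∧ ⇑Φ = f := by
  obtain ⟨t, ht, htinj⟩ := hinj.exists_mem_nhdsSet hS
    (fun y hy => (hf y hy).contMDiffAt.continuousAt) fun y hy => by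
      obtain ⟨Φ, hyΦ, hΦ⟩ := hf y hy
      exact ⟨Φ.source, Φ.open_source.mem_nhds hyΦ, Φ.injOn.congr hΦ.symm⟩
  obtain ⟨V, hV, hSV, hVt⟩ := mem_nhdsSet_iff_exists.1 ht
  exact ⟨partialDiffeomorphOfInjOn (hV.inter (isOpen_setOf_isLocalDiffeomorphAt f))
    (fun y hy => hy.2) (htinj.mono fun y hy => hVt hy.1), fun y hy => ⟨hSV hy, hf y hy⟩, rfl⟩

end

section VectorSpaces

variable {E F : Type*} [NormedAddCommGroup E] [NormedSpace ℝ E] [NormedAddCommGroup F]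
  [NormedSpace ℝ F] {M N : Type*} [TopologicalSpace M] [ChartedSpace E M]
  [TopologicalSpace N] [ChartedSpace F N]

/-- A chart of the maximal atlas, as a partial diffeomorphism to the model space. -/
def chartPartialDiffeomorph [IsManifold 𝓘(ℝ, E) ∞ M] (e : OpenPartialHomeomorph M E)
    (he : e ∈ IsManifold.maximalAtlas 𝓘(ℝ, E) ∞ M) :
    PartialDiffeomorph 𝓘(ℝ, E) 𝓘(ℝ, E) M E ∞ where
  toPartialEquiv := e.toPartialEquiv
  open_source := e.open_source
  open_target := e.open_target
  contMDiffOn_toFun := contMDiffOn_of_mem_maximalAtlas he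
  contMDiffOn_invFun := contMDiffOn_symm_of_mem_maximalAtlas he

theorem isLocalDiffeomorphAt_chartAt [IsManifold 𝓘(ℝ, E) ∞ M] (x : M) :
    IsLocalDiffeomorphAt 𝓘(ℝ, E) 𝓘(ℝ, E) ∞ (chartAt E x) x :=
  (chartPartialDiffeomorph _ (IsManifold.chart_mem_maximalAtlas x)).isLocalDiffeomorphAt _ _ _
    (mem_chart_source E x)

theorem exists_partialDiffeomorph_apply_eq_zero [IsManifold 𝓘(ℝ, E) ∞ M] (x : M) :
    ∃ c : PartialDiffeomorph 𝓘(ℝ, E) 𝓘(ℝ, E) M E ∞, x ∈ c.source ∧ c x = 0 := by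
  let τ : Diffeomorph 𝓘(ℝ, E) 𝓘(ℝ, E) E E ∞ :=
    { toEquiv := Equiv.subRight (chartAt E x x)
      contMDiff_toFun := (contDiff_id.sub contDiff_const).contMDiff
      contMDiff_invFun := (contDiff_id.add contDiff_const).contMDiff }
  obtain ⟨c, hx, hc⟩ :=
    (isLocalDiffeomorphAt_chartAt x).comp _ _ (τ.isLocalDiffeomorph (chartAt E x x))
  exact ⟨c, hx, (hc hx).symm.trans (sub_self _)⟩

theorem isLocalDiffeomorphAt_subtype_val [IsManifold 𝓘(ℝ, E) ∞ M] (U : Opens M) (y : U) :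
    IsLocalDiffeomorphAt 𝓘(ℝ, E) 𝓘(ℝ, E) ∞ (Subtype.val : U → M) y := by
  let e := U.openPartialHomeomorphSubtypeCoe ⟨y⟩
  refine ⟨⟨e.toPartialEquiv, e.open_source, e.open_target, contMDiff_subtype_val.contMDiffOn,
    fun z hz => ContMDiffAt.contMDiffWithinAt ?_⟩, trivial, fun z _ => rfl⟩
  rw [← ContMDiffAt.subtypeVal_comp_iff]
  refine contMDiffAt_id.congr_of_eventuallyEq ?_
  filter_upwards [e.open_target.mem_nhds hz] with w hw
  exact e.right_inv hw

theorem exists_diffeomorph_of_bijOn [IsManifold 𝓘(ℝ, E) ∞ M] {F' H N : Type*}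
    [NormedAddCommGroup F'] [NormedSpace ℝ F'] [TopologicalSpace H] {J : ModelWithCorners ℝ F' H}
    [TopologicalSpace N] [ChartedSpace H N] (U : Opens M) {f : M → N}
    (hf : ∀ y ∈ U, IsLocalDiffeomorphAt 𝓘(ℝ, E) J ∞ f y) (hbij : BijOn f U univ) :
    ∃ Φ : Diffeomorph 𝓘(ℝ, E) J U N ∞, ∀ y, Φ y = f y := by
  have hloc : IsLocalDiffeomorph 𝓘(ℝ, E) J ∞ (fun y : U => f y) := fun y =>
    (isLocalDiffeomorphAt_subtype_val U y).comp _ _ (hf y y.2)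
  have hbij' : Function.Bijective (fun y : U => f y) := by
    refine ⟨hbij.injOn.injective, fun z => ?_⟩
    obtain ⟨y, hy, rfl⟩ := hbij.surjOn (mem_univ z)
    exact ⟨⟨y, hy⟩, rfl⟩
  exact ⟨hloc.diffeomorphOfBijective hbij', fun y => rfl⟩

theorem isLocalDiffeomorphAt_prodMap {E₁ E₂ F₁ F₂ : Type*}
    [NormedAddCommGroup E₁] [NormedSpace ℝ E₁] [NormedAddCommGroup E₂] [NormedSpace ℝ E₂]
    [NormedAddCommGroup F₁] [NormedSpace ℝ F₁] [NormedAddCommGroup F₂] [NormedSpace ℝ F₂]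
    {M₁ M₂ N₁ N₂ : Type*}
    [TopologicalSpace M₁] [ChartedSpace E₁ M₁] [TopologicalSpace M₂] [ChartedSpace E₂ M₂]
    [TopologicalSpace N₁] [ChartedSpace F₁ N₁] [TopologicalSpace N₂] [ChartedSpace F₂ N₂]
    {f : M₁ → N₁} {g : M₂ → N₂} {p : M₁ × M₂}
    (hf : IsLocalDiffeomorphAt 𝓘(ℝ, E₁) 𝓘(ℝ, F₁) ∞ f p.1)
    (hg : IsLocalDiffeomorphAt 𝓘(ℝ, E₂) 𝓘(ℝ, F₂) ∞ g p.2) :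
    IsLocalDiffeomorphAt (𝓘(ℝ, E₁).prod 𝓘(ℝ, E₂)) (𝓘(ℝ, F₁).prod 𝓘(ℝ, F₂)) ∞
      (Prod.map f g) p := by
  obtain ⟨Φ, hΦ, hf⟩ := hf
  obtain ⟨Ψ, hΨ, hg⟩ := hg
  let e := Φ.toOpenPartialHomeomorph.prod Ψ.toOpenPartialHomeomorph
  exact ⟨⟨e.toPartialEquiv, e.open_source, e.open_target,
    Φ.contMDiffOn_toFun.prodMap Ψ.contMDiffOn_toFun,
    Φ.contMDiffOn_invFun.prodMap Ψ.contMDiffOn_invFun⟩, ⟨hΦ, hΨ⟩,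
    fun q hq => Prod.ext (hf hq.1) (hg hq.2)⟩

variable (E F) in
/-- The identity of `E × F`, from its manifold structure modelled on the vector space `E × F` to its
structure of product manifold. -/
def prodSelfDiffeomorph :
    Diffeomorph 𝓘(ℝ, E × F) (𝓘(ℝ, E).prod 𝓘(ℝ, F)) (E × F) (E × F) ∞ where
  toEquiv := Equiv.refl _
  contMDiff_toFun := contDiff_fst.contMDiff.prodMk contDiff_snd.contMDiff
  contMDiff_invFun := ContMDiff.prodMk_space contMDiff_fst contMDiff_snd

theorem isLocalDiffeomorphAt_of_hasFDerivAt [CompleteSpace E] {f : E → F} {a : E}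
    (hf : ∀ᶠ y in 𝓝 a, ContDiffAt ℝ ∞ f y) (f' : E ≃L[ℝ] F)
    (hf' : HasFDerivAt f (f' : E →L[ℝ] F) a) :
    IsLocalDiffeomorphAt 𝓘(ℝ, E) 𝓘(ℝ, F) ∞ f a := by
  have hfa : ContDiffAt ℝ ∞ f a := hf.self_of_nhds
  let e := hfa.toOpenPartialHomeomorph f hf' (by simp)
  have hinv : ∀ᶠ y in 𝓝 a, fderiv ℝ f y ∈ range ((↑) : (E ≃L[ℝ] F) → E →L[ℝ] F) :=
    (hfa.continuousAt_fderiv (by simp)).eventually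
      (ContinuousLinearEquiv.isOpen.mem_nhds ⟨f', hf'.fderiv.symm⟩)
  obtain ⟨O, hO, hOo, haO⟩ := eventually_nhds_iff.1 (hf.and hinv)
  let e' := e.restrOpen O hOo
  refine ⟨⟨e'.toPartialEquiv, e'.open_source, e'.open_target, fun y hy => ?_, fun y hy => ?_⟩,
    ⟨hfa.mem_toOpenPartialHomeomorph_source hf' (by simp), haO⟩, fun _ _ => rfl⟩
  · exact (hO y hy.2).1.contMDiffAt.contMDiffWithinAt
  · obtain ⟨hsmooth, g', hg'⟩ := hO (e'.symm y) (e'.map_target hy).2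
    refine (e'.contDiffAt_symm (f₀' := g') hy ?_ hsmooth).contMDiffAt.contMDiffWithinAt
    rw [hg']
    exact (hsmooth.differentiableAt (by simp)).hasFDerivAt

end VectorSpaces

end LocalDiffeomorphisms

section Calculus

open Filter Set

theorem eventually_forall_smul_snd {A B : Type*} [TopologicalSpace A] [AddCommGroup B]
    [Module ℝ B] [TopologicalSpace B] [ContinuousSMul ℝ B] {P : A × B → Prop} {a₀ : A}
    (hP : ∀ᶠ p in 𝓝 (a₀, (0 : B)), P p) :
    ∀ᶠ p in 𝓝 (a₀, (0 : B)), ∀ l ∈ Icc (0 : ℝ) 1, P (p.1, l • p.2) := by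
  refine isCompact_Icc.eventually_forall_of_forall_eventually fun l _ => ?_
  have hcont : Continuous fun q : (A × B) × ℝ => (q.1.1, q.2 • q.1.2) := by fun_prop
  exact (hcont.tendsto' ((a₀, 0), l) (a₀, 0) (by simp)).eventually hP

variable {A B C : Type*} [NormedAddCommGroup A] [NormedSpace ℝ A] [NormedAddCommGroup B]
  [NormedSpace ℝ B]

/-- The derivative of `(a, b) ↦ (F (a, b), b)` is block triangular with identity diagonal blocks. -/
theorem isLocalDiffeomorphAt_prodMk_snd [CompleteSpace A] [CompleteSpace B] {F : A × B → A} {a₀ : A}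
    (hF : ∀ᶠ p in 𝓝 (a₀, (0 : B)), ContDiffAt ℝ ∞ F p)
    (hF0 : ∀ᶠ a in 𝓝 a₀, F (a, 0) = a) :
    IsLocalDiffeomorphAt 𝓘(ℝ, A × B) 𝓘(ℝ, A × B) ∞ (fun p => (F p, p.2)) (a₀, 0) := by
  have hFd : HasFDerivAt F (fderiv ℝ F (a₀, 0)) (a₀, 0) :=
    (hF.self_of_nhds.differentiableAt (by simp)).hasFDerivAt
  have hinl : (fderiv ℝ F (a₀, 0)).comp (.inl ℝ A B) = .id ℝ A :=
    (hFd.comp a₀ (ContinuousLinearMap.inl ℝ A B).hasFDerivAt).unique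
      ((hasFDerivAt_id a₀).congr_of_eventuallyEq hF0)
  let D : (A × B) ≃L[ℝ] (A × B) := (ContinuousLinearEquiv.prodComm ℝ A B).trans
    (((ContinuousLinearEquiv.refl ℝ B).skewProd (.refl ℝ A)
      ((fderiv ℝ F (a₀, 0)).comp (.inr ℝ A B))).trans (.prodComm ℝ B A))
  refine isLocalDiffeomorphAt_of_hasFDerivAt
    (hF.mono fun p hp => hp.prodMk contDiffAt_snd) D ?_
  have hD : (D : A × B →L[ℝ] A × B) = (fderiv ℝ F (a₀, 0)).prod (.snd ℝ A B) := by
    refine ContinuousLinearMap.ext fun v => Prod.ext ?_ rfl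
    have hv1 : fderiv ℝ F (a₀, 0) (v.1, 0) = v.1 := DFunLike.congr_fun hinl v.1
    calc v.1 + fderiv ℝ F (a₀, 0) (0, v.2)
        = fderiv ℝ F (a₀, 0) (v.1, 0) + fderiv ℝ F (a₀, 0) (0, v.2) := by rw [hv1]
      _ = fderiv ℝ F (a₀, 0) v := by rw [← map_add]; simp
  rw [hD]
  exact hFd.prodMk hasFDerivAt_snd

theorem exists_norm_le_mul_norm_snd [NormedAddCommGroup C] [NormedSpace ℝ C] {T : A × B → C}
    {a₀ : A} (hT : ContDiffAt ℝ 1 T (a₀, 0)) (hT0 : ∀ᶠ a in 𝓝 a₀, T (a, 0) = 0) :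
    ∃ L : ℝ, ∀ᶠ p in 𝓝 (a₀, (0 : B)), ‖T p‖ ≤ L * ‖p.2‖ := by
  obtain ⟨L, t, ht, hL⟩ := hT.exists_lipschitzOnWith
  have hcont : Continuous fun p : A × B => (p.1, (0 : B)) := by fun_prop
  refine ⟨L, ?_⟩
  filter_upwards [ht, hcont.tendsto' (a₀, 0) (a₀, 0) rfl ht,
    (continuous_fst.tendsto (a₀, (0 : B))).eventually hT0] with p hp hp' hp0
  have hsub : p - (p.1, 0) = (0, p.2) := by ext <;> simp
  simpa [hp0, dist_eq_norm, hsub, Prod.norm_def] using hL.dist_le_mul p hp _ hp'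

/-- Both `T p` and `T' p (0, p.2)` are close to `T' (a₀, 0) (0, p.2)`. -/
theorem eventually_norm_sub_fderiv_le [NormedAddCommGroup C] [NormedSpace ℝ C] {T : A × B → C}
    {a₀ : A} (hT : ContDiffAt ℝ 1 T (a₀, 0)) (hT0 : ∀ᶠ a in 𝓝 a₀, T (a, 0) = 0) {ε : ℝ}
    (hε : 0 < ε) : ∀ᶠ p in 𝓝 (a₀, (0 : B)), ‖T p - fderiv ℝ T p (0, p.2)‖ ≤ ε * ‖p.2‖ := by
  have hcont : Continuous fun p : A × B => (p, (p.1, (0 : B))) := by fun_prop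
  have hstrict := (hT.hasStrictFDerivAt (by simp)).isLittleO.def (half_pos hε)
  have hderiv : ∀ᶠ p in 𝓝 (a₀, (0 : B)), ‖fderiv ℝ T (a₀, 0) - fderiv ℝ T p‖ < ε / 2 := by
    have hnorm : ContinuousAt (fun p => ‖fderiv ℝ T (a₀, 0) - fderiv ℝ T p‖) (a₀, 0) :=
      (continuousAt_const.sub (hT.continuousAt_fderiv (by simp))).norm
    exact hnorm.eventually_lt_const (by simpa using half_pos hε)
  filter_upwards [(hcont.tendsto' (a₀, 0) ((a₀, 0), (a₀, 0)) rfl).eventually hstrict, hderiv,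
    (continuous_fst.tendsto (a₀, (0 : B))).eventually hT0] with p hp hdp hp0
  have hsub : p - (p.1, 0) = (0, p.2) := by ext <;> simp
  have hnorm : ‖((0 : A), p.2)‖ = ‖p.2‖ := by simp [Prod.norm_def]
  simp only [hsub, hp0, sub_zero, hnorm] at hp
  calc ‖T p - fderiv ℝ T p (0, p.2)‖
      = ‖(T p - fderiv ℝ T (a₀, 0) (0, p.2)) + (fderiv ℝ T (a₀, 0) - fderiv ℝ T p) (0, p.2)‖ := by
        simp
    _ ≤ ε / 2 * ‖p.2‖ + ε / 2 * ‖p.2‖ := norm_add_le_of_le hp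
        (((fderiv ℝ T (a₀, 0) - fderiv ℝ T p).le_of_opNorm_le hdp.le _).trans_eq (by rw [hnorm]))
    _ = ε * ‖p.2‖ := by ring

section Radial

variable [NormedAddCommGroup C] [InnerProductSpace ℝ C] {T : A × B → C} {a₀ : A} {L : ℝ}

theorem eventually_inner_fderiv_snd_nonneg (hT : ContDiffAt ℝ 1 T (a₀, 0))
    (hT0 : ∀ᶠ a in 𝓝 a₀, T (a, 0) = 0)
    (hL : ∀ᶠ p in 𝓝 (a₀, (0 : B)), ‖p.2‖ ≤ L * ‖T p‖) :
    ∀ᶠ p in 𝓝 (a₀, (0 : B)), 0 ≤ inner ℝ (T p) (fderiv ℝ T p (0, p.2)) := by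
  have hL' : 0 < max L 1 := by positivity
  filter_upwards [eventually_norm_sub_fderiv_le hT hT0 (inv_pos.2 hL'), hL] with p hp hLp
  have hle : ‖T p - fderiv ℝ T p (0, p.2)‖ ≤ ‖T p‖ :=
    calc ‖T p - fderiv ℝ T p (0, p.2)‖ ≤ (max L 1)⁻¹ * ‖p.2‖ := hp
      _ ≤ (max L 1)⁻¹ * (max L 1 * ‖T p‖) := by
        gcongr
        exact hLp.trans (by gcongr; exact le_max_left _ _)
      _ = ‖T p‖ := inv_mul_cancel_left₀ hL'.ne' _
  have hinner := real_inner_le_norm (T p) (T p - fderiv ℝ T p (0, p.2))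
  rw [inner_sub_right, real_inner_self_eq_norm_sq] at hinner
  nlinarith [norm_nonneg (T p)]

theorem eventually_forall_norm_smul_snd_le (hT : ContDiffAt ℝ 1 T (a₀, 0))
    (hT0 : ∀ᶠ a in 𝓝 a₀, T (a, 0) = 0)
    (hL : ∀ᶠ p in 𝓝 (a₀, (0 : B)), ‖p.2‖ ≤ L * ‖T p‖) :
    ∀ᶠ p in 𝓝 (a₀, (0 : B)), ∀ l ∈ Icc (0 : ℝ) 1, ‖T (p.1, l • p.2)‖ ≤ ‖T p‖ := by
  filter_upwards [eventually_forall_smul_snd ((hT.eventually (by simp)).and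
    (eventually_inner_fderiv_snd_nonneg hT hT0 hL))] with p hp
  have hderiv : ∀ l ∈ Icc (0 : ℝ) 1, HasDerivAt (fun l : ℝ => T (p.1, l • p.2))
      (fderiv ℝ T (p.1, l • p.2) (0, p.2)) l := fun l hl =>
    ((hp l hl).1.differentiableAt (by simp)).hasFDerivAt.comp_hasDerivAt l
      ((hasDerivAt_const l p.1).prodMk (by simpa using (hasDerivAt_id l).smul_const p.2))
  have hmono : MonotoneOn (fun l : ℝ => ‖T (p.1, l • p.2)‖ ^ 2) (Icc 0 1) := by
    refine monotoneOn_of_deriv_nonneg (convex_Icc 0 1)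
      (fun l hl => (hderiv l hl).norm_sq.continuousAt.continuousWithinAt)
      (fun l hl =>
        (hderiv l (interior_subset hl)).norm_sq.differentiableAt.differentiableWithinAt)
      fun l hl => ?_
    have hl0 : 0 < l := (interior_Icc.subset hl).1
    have hinner := (hp l (interior_subset hl)).2
    have hsmul : ((0 : A), l • p.2) = l • ((0 : A), p.2) := by simp
    rw [hsmul, map_smul, inner_smul_right] at hinner
    rw [(hderiv l (interior_subset hl)).norm_sq.deriv]
    linarith [nonneg_of_mul_nonneg_right hinner hl0]
  intro l hl
  simpa [sq_le_sq₀] using hmono hl (right_mem_Icc.2 zero_le_one) hl.2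

end Radial

end Calculus

section StarShaped

open Set

theorem deriv_smoothTransition_eq_zero {u : ℝ} (hu : u ∉ Ioo (0 : ℝ) 1) :
    deriv Real.smoothTransition u = 0 := by
  rcases not_and_or.1 hu with h | h
  · refine IsLocalMin.deriv_eq_zero (.of_forall fun w => ?_)
    rw [Real.smoothTransition.zero_of_nonpos (not_lt.1 h)]
    exact Real.smoothTransition.nonneg w
  · refine IsLocalMax.deriv_eq_zero (.of_forall fun w => ?_)
    rw [Real.smoothTransition.one_of_one_le (not_lt.1 h)]
    exact Real.smoothTransition.le_one w

theorem one_le_integral_inv_sq_near_zero {f : ℝ → ℝ} {b : ℝ} (hb : 0 < b)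
    (hf : ContinuousOn f (Ico 0 b)) (hpos : ∀ t ∈ Ico 0 b, 0 < f t) (hfb : f b = 0)
    (hd : DifferentiableAt ℝ f b) :
    ∃ l ∈ Ico 0 b, 1 ≤ ∫ t in (0 : ℝ)..l, (f t ^ 2)⁻¹ := by
  obtain ⟨C, hC, hCb⟩ := hd.isBigO_sub.exists_pos
  obtain ⟨ε, hε, hball⟩ := Metric.eventually_nhds_iff_ball.1 hCb.bound
  -- On `[b - 2u, b - u]` one has `f ≤ 2Cu`, so the integral over it is at least `u / (2Cu)²`.
  let u := min (ε / 4) (min (b / 2) (1 / (4 * C ^ 2)))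
  have hu : 0 < u := by positivity
  have huε : u ≤ ε / 4 := min_le_left _ _
  have hub : u ≤ b / 2 := (min_le_right _ _).trans (min_le_left _ _)
  have huC : u * (4 * C ^ 2) ≤ 1 :=
    (le_div_iff₀ (by positivity)).1 ((min_le_right _ _).trans (min_le_right _ _))
  have hint {a c : ℝ} (ha : 0 ≤ a) (hac : a ≤ c) (hcb : c < b) :
      IntervalIntegrable (fun t => (f t ^ 2)⁻¹) MeasureTheory.volume a c := by
    have hsub : Icc a c ⊆ Ico 0 b := fun t ht => ⟨ha.trans ht.1, ht.2.trans_lt hcb⟩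
    refine ContinuousOn.intervalIntegrable_of_Icc hac ?_
    exact ((hf.mono hsub).pow 2).inv₀ fun t ht => (pow_pos (hpos t (hsub ht)) 2).ne'
  refine ⟨b - u, ⟨by linarith, by linarith⟩, ?_⟩
  calc (1 : ℝ) ≤ ∫ _t in (b - 2 * u)..(b - u), (4 * C ^ 2 * u ^ 2)⁻¹ := by
        rw [intervalIntegral.integral_const, smul_eq_mul, ← div_eq_mul_inv,
          le_div_iff₀ (by positivity)]
        nlinarith
    _ ≤ ∫ t in (b - 2 * u)..(b - u), (f t ^ 2)⁻¹ := by
        refine intervalIntegral.integral_mono_on (by linarith) intervalIntegrable_const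
          (hint (by linarith) (by linarith) (by linarith)) fun t ht => ?_
        have hft : 0 < f t := hpos t ⟨by linarith [ht.1], by linarith [ht.2]⟩
        have hlip := hball t (by
          rw [Metric.mem_ball, Real.dist_eq, abs_lt]; constructor <;> linarith [ht.1, ht.2])
        rw [hfb, sub_zero, Real.norm_eq_abs, Real.norm_eq_abs, abs_of_pos hft,
          abs_sub_comm, abs_of_nonneg (by linarith [ht.2])] at hlip
        have hfu : f t ≤ 2 * C * u := by nlinarith [ht.1]
        exact inv_anti₀ (pow_pos hft 2) (by linarith [pow_le_pow_left₀ hft.le hfu 2])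
    _ ≤ ∫ t in (0 : ℝ)..(b - u), (f t ^ 2)⁻¹ :=
        intervalIntegral.integral_mono_interval (by linarith) (by linarith) le_rfl
          (.of_forall fun t => by positivity) (hint le_rfl (by linarith) (by linarith))

variable {E : Type*} [NormedAddCommGroup E] [NormedSpace ℝ E] {Ω : Set E} {ρ : E → ℝ}

theorem exists_exit_time (hΩ : IsOpen Ω) (h0 : (0 : E) ∈ Ω) {v : E} {c : ℝ} (hc : 0 ≤ c)
    (hcv : c • v ∉ Ω) :
    ∃ b : ℝ, 0 < b ∧ b • v ∉ Ω ∧ ∀ t ∈ Ico 0 b, t • v ∈ Ω := by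
  let A : Set ℝ := Ici 0 ∩ (fun t : ℝ => t • v) ⁻¹' Ωᶜ
  have hA : IsClosed A := isClosed_Ici.inter (hΩ.isClosed_compl.preimage (by fun_prop))
  have hbdd : BddBelow A := ⟨0, fun t ht => ht.1⟩
  have hmem : sInf A ∈ A := hA.csInf_mem ⟨c, hc, hcv⟩ hbdd
  refine ⟨sInf A, lt_of_le_of_ne hmem.1 fun h => hmem.2 ?_, hmem.2, fun t ht => ?_⟩
  · rw [← h]
    simpa using h0
  · by_contra hcon
    exact ht.2.not_ge (csInf_le hbdd ⟨ht.1, hcon⟩)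

/-- The mean value of `ρ` on the segment from `0` to `x`. -/
noncomputable def segmentMean (ρ : E → ℝ) (x : E) : ℝ := ∫ t in (0 : ℝ)..1, ρ (t • x)

theorem mul_segmentMean_smul (ρ : E → ℝ) (x : E) (l : ℝ) :
    l * segmentMean ρ (l • x) = ∫ t in (0 : ℝ)..l, ρ (t • x) := by
  simpa [segmentMean, mul_smul] using
    intervalIntegral.mul_integral_comp_mul_right (a := 0) (b := 1) (f := fun t => ρ (t • x)) l

theorem smul_mem_of_smul_mem (hΩ : StarConvex ℝ 0 Ω) {x : E} {t l : ℝ} (hl : l • x ∈ Ω)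
    (ht : t ∈ Icc 0 l) : t • x ∈ Ω := by
  rcases (ht.1.trans ht.2).eq_or_lt with rfl | hl0
  · rwa [le_antisymm ht.2 ht.1]
  · have := hΩ.smul_mem hl (div_nonneg ht.1 hl0.le) (div_le_one_of_le₀ ht.2 hl0.le)
    rwa [smul_smul, div_mul_cancel₀ _ hl0.ne'] at this

theorem continuousOn_comp_smul_Icc (hΩ : StarConvex ℝ 0 Ω) (hρ : ContinuousOn ρ Ω) {x : E} {l : ℝ}
    (hl : l • x ∈ Ω) : ContinuousOn (fun t : ℝ => ρ (t • x)) (Icc 0 l) :=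
  hρ.comp (by fun_prop) fun _ ht => smul_mem_of_smul_mem hΩ hl ht

theorem segmentMean_pos (hΩ : StarConvex ℝ 0 Ω) (hρ : ContinuousOn ρ Ω) (hpos : ∀ x ∈ Ω, 0 < ρ x)
    {x : E} (hx : x ∈ Ω) : 0 < segmentMean ρ x := by
  refine intervalIntegral.integral_pos zero_lt_one
    (continuousOn_comp_smul_Icc hΩ hρ (by simpa using hx))
    (fun t ht => (hpos _ (hΩ.smul_mem hx ht.1.le ht.2)).le)
    ⟨1, right_mem_Icc.2 zero_le_one, by simpa using hpos x hx⟩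

/-- The substitution `t = smoothTransition u` turns the mean into an integral over `ℝ` whose
integrand is compactly supported, to which the smoothness of convolutions applies. -/
theorem segmentMean_eq_integral_smoothTransition (hΩ : StarConvex ℝ 0 Ω) (hρ : ContinuousOn ρ Ω)
    {x : E} (hx : x ∈ Ω) :
    segmentMean ρ x = ∫ u, ρ (Real.smoothTransition u • x) * deriv Real.smoothTransition u := by
  have hsubst := intervalIntegral.integral_comp_mul_deriv' (a := 0) (b := 1)
    (f := Real.smoothTransition) (f' := deriv Real.smoothTransition) (g := fun t => ρ (t • x))
    (fun u _ => ((Real.smoothTransition.contDiff (n := 1)).differentiable one_ne_zero u).hasDerivAt)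
    (Real.smoothTransition.contDiff (n := 1)).continuous_deriv_one.continuousOn (by
      refine hρ.comp (by fun_prop) ?_
      rintro _ ⟨u, -, rfl⟩
      exact hΩ.smul_mem hx (Real.smoothTransition.nonneg u) (Real.smoothTransition.le_one u))
  rw [Real.smoothTransition.zero, Real.smoothTransition.one] at hsubst
  rw [segmentMean, ← hsubst]
  refine intervalIntegral.integral_eq_integral_of_support_subset fun u hu => ?_
  by_contra hcon
  exact hu (by simp [deriv_smoothTransition_eq_zero fun h => hcon (Ioo_subset_Ioc_self h)])

theorem contDiffOn_segmentMean (hΩo : IsOpen Ω) (hΩ : StarConvex ℝ 0 Ω)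
    (hρ : ContDiffOn ℝ ∞ ρ Ω) : ContDiffOn ℝ ∞ (segmentMean ρ) Ω := by
  let g : E → ℝ → ℝ := fun x u =>
    ρ (Real.smoothTransition (-u) • x) * deriv Real.smoothTransition (-u)
  have hst : ContDiff ℝ ∞ Real.smoothTransition := Real.smoothTransition.contDiff
  have hg : ContDiffOn ℝ ∞ ↿g (Ω ×ˢ univ) := by
    refine ContDiffOn.mul (hρ.comp (f := fun p : E × ℝ => Real.smoothTransition (-p.2) • p.1)
      ((hst.comp contDiff_snd.neg).smul contDiff_fst).contDiffOn fun p hp => ?_)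
      ((contDiff_infty_iff_deriv.1 hst).2.comp contDiff_snd.neg).contDiffOn
    exact hΩ.smul_mem hp.1 (Real.smoothTransition.nonneg _) (Real.smoothTransition.le_one _)
  have hg0 (x : E) (u : ℝ) (_ : x ∈ Ω) (hu : u ∉ Icc (-1 : ℝ) 0) : g x u = 0 := by
    have : -u ∉ Ioo (0 : ℝ) 1 := fun h => hu ⟨by linarith [h.2], by linarith [h.1]⟩
    simp [g, deriv_smoothTransition_eq_zero this]
  refine (MeasureTheory.contDiffOn_convolution_right_with_param_comp
    (μ := MeasureTheory.volume) (ContinuousLinearMap.mul ℝ ℝ) (v := fun _ => (0 : ℝ))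
    contDiffOn_const (f := fun _ => (1 : ℝ)) hΩo isCompact_Icc hg0
    (MeasureTheory.locallyIntegrable_const _) hg).congr fun x hx => ?_
  rw [segmentMean_eq_integral_smoothTransition hΩ hρ.continuousOn hx]
  simp [MeasureTheory.convolution, g]

theorem segmentMean_add_fderiv (hΩo : IsOpen Ω) (hΩ : StarConvex ℝ 0 Ω) (hρ : ContDiffOn ℝ ∞ ρ Ω)
    {x : E} (hx : x ∈ Ω) : segmentMean ρ x + fderiv ℝ (segmentMean ρ) x x = ρ x := by
  have hopen : IsOpen ((fun t : ℝ => t • x) ⁻¹' Ω) := hΩo.preimage (by fun_prop)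
  have hcont : ContinuousOn (fun t : ℝ => ρ (t • x)) ((fun t : ℝ => t • x) ⁻¹' Ω) :=
    hρ.continuousOn.comp (by fun_prop) fun _ h => h
  have hmem : (1 : ℝ) ∈ (fun t : ℝ => t • x) ⁻¹' Ω := by simpa using hx
  have hFTC : HasDerivAt (fun l => l * segmentMean ρ (l • x)) (ρ x) 1 := by
    simp_rw [mul_segmentMean_smul]
    simpa using intervalIntegral.integral_hasDerivAt_right
      ((continuousOn_comp_smul_Icc hΩ hρ.continuousOn hmem).intervalIntegrable_of_Icc zero_le_one)
      (hcont.stronglyMeasurableAtFilter hopen _ hmem) (hcont.continuousAt (hopen.mem_nhds hmem))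
  have hD : HasFDerivAt (segmentMean ρ) (fderiv ℝ (segmentMean ρ) x) ((1 : ℝ) • x) := by
    rw [one_smul]
    exact (((contDiffOn_segmentMean hΩo hΩ hρ).contDiffAt (hΩo.mem_nhds hx)).differentiableAt
      (by simp)).hasFDerivAt
  have hline : HasDerivAt (fun l : ℝ => l • x) x 1 := by
    simpa using (hasDerivAt_id (1 : ℝ)).smul_const x
  have hprod : HasDerivAt (fun l => l * segmentMean ρ (l • x))
      (segmentMean ρ x + fderiv ℝ (segmentMean ρ) x x) 1 := by
    simpa [Function.comp_def, Pi.mul_def] using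
      (hasDerivAt_id' (1 : ℝ)).mul (hD.comp_hasDerivAt 1 hline)
  exact hprod.unique hFTC

/-- The map preserving each ray from the origin with radial derivative `ρ`. It is used with a `ρ`
that blows up at the boundary of a star-shaped set, to stretch this set over the whole space. -/
noncomputable def radialStretch (ρ : E → ℝ) (x : E) : E := segmentMean ρ x • x

theorem radialStretch_zero (ρ : E → ℝ) : radialStretch ρ 0 = 0 := smul_zero _

theorem injective_smul_id_add_smulRight {a : ℝ} {ℓ : E →L[ℝ] ℝ} {x : E} (ha : a ≠ 0)
    (hax : a + ℓ x ≠ 0) :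
    Function.Injective (a • ContinuousLinearMap.id ℝ E + ℓ.smulRight x) := by
  refine (injective_iff_map_eq_zero _).2 fun v hv => ?_
  have hv' : a • v + ℓ v • x = 0 := by simpa using hv
  have hℓ : ℓ v = 0 := by
    have := congrArg ℓ hv'
    rw [map_add, map_smul, map_smul, map_zero, smul_eq_mul, smul_eq_mul] at this
    exact (mul_eq_zero.1 (show (a + ℓ x) * ℓ v = 0 by linarith)).resolve_left hax
  simpa [hℓ, ha] using hv'

theorem isLocalDiffeomorphAt_radialStretch [FiniteDimensional ℝ E] (hΩo : IsOpen Ω)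
    (hΩ : StarConvex ℝ 0 Ω) (hρ : ContDiffOn ℝ ∞ ρ Ω) (hpos : ∀ x ∈ Ω, 0 < ρ x) {x : E}
    (hx : x ∈ Ω) : IsLocalDiffeomorphAt 𝓘(ℝ, E) 𝓘(ℝ, E) ∞ (radialStretch ρ) x := by
  have hsm := contDiffOn_segmentMean hΩo hΩ hρ
  have hinj := injective_smul_id_add_smulRight (segmentMean_pos hΩ hρ.continuousOn hpos hx).ne'
    ((segmentMean_add_fderiv hΩo hΩ hρ hx).trans_ne (hpos x hx).ne')
  refine isLocalDiffeomorphAt_of_hasFDerivAt ?_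
    (LinearEquiv.ofInjectiveEndo _ hinj).toContinuousLinearEquiv ?_
  · filter_upwards [hΩo.mem_nhds hx] with y hy
    exact (hsm.contDiffAt (hΩo.mem_nhds hy)).smul contDiffAt_id
  · exact ((hsm.contDiffAt (hΩo.mem_nhds hx)).differentiableAt (by simp)).hasFDerivAt.smul
      (hasFDerivAt_id x)

theorem strictMonoOn_mul_segmentMean_smul (hΩ : StarConvex ℝ 0 Ω) (hρ : ContinuousOn ρ Ω)
    (hpos : ∀ x ∈ Ω, 0 < ρ x) {x : E} (hx : x ∈ Ω) :
    StrictMonoOn (fun l : ℝ => l * segmentMean ρ (l • x)) (Icc 0 1) := by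
  intro a ha b hb hab
  simp only [mul_segmentMean_smul]
  have hcont := continuousOn_comp_smul_Icc hΩ hρ (x := x) (l := 1) (by simpa using hx)
  have hint {c d : ℝ} (hc : 0 ≤ c) (hcd : c ≤ d) (hd : d ≤ 1) :
      IntervalIntegrable (fun t : ℝ => ρ (t • x)) MeasureTheory.volume c d :=
    (hcont.mono (Icc_subset_Icc hc hd)).intervalIntegrable_of_Icc hcd
  rw [← intervalIntegral.integral_add_adjacent_intervals (hint le_rfl ha.1 ha.2)
    (hint ha.1 hab.le hb.2)]
  exact lt_add_of_pos_right _ (intervalIntegral.intervalIntegral_pos_of_pos_on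
    (hint ha.1 hab.le hb.2)
    (fun t ht => hpos _ (hΩ.smul_mem hx (ha.1.trans ht.1.le) (ht.2.le.trans hb.2))) hab)

theorem injOn_radialStretch (hΩ : StarConvex ℝ 0 Ω) (hρ : ContinuousOn ρ Ω)
    (hpos : ∀ x ∈ Ω, 0 < ρ x) : InjOn (radialStretch ρ) Ω := by
  intro x hx y hy hxy
  wlog hle : segmentMean ρ x ≤ segmentMean ρ y generalizing x y
  · exact (this hy hx hxy.symm (le_of_not_ge hle)).symm
  have hx0 := segmentMean_pos hΩ hρ hpos hx
  have hy0 := segmentMean_pos hΩ hρ hpos hy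
  let l := segmentMean ρ x / segmentMean ρ y
  have hyx : y = l • x := by
    rw [show l = _ from div_eq_inv_mul _ _, mul_smul, show segmentMean ρ x • x = _ from hxy,
      radialStretch, smul_smul, inv_mul_cancel₀ hy0.ne', one_smul]
  have hl : l * segmentMean ρ (l • x) = 1 * segmentMean ρ ((1 : ℝ) • x) := by
    rw [← hyx, one_smul, one_mul, div_mul_cancel₀ _ hy0.ne']
  have hl1 : l = 1 := (strictMonoOn_mul_segmentMean_smul hΩ hρ hpos hx).injOn
    ⟨by positivity, (div_le_one hy0).2 hle⟩ (right_mem_Icc.2 zero_le_one) hl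
  rw [hyx, hl1, one_smul]

theorem exists_radialStretch_eq (hΩ : StarConvex ℝ 0 Ω) (hρ : ContinuousOn ρ Ω) {v : E} {l : ℝ}
    (hl : 0 ≤ l) (hlv : l • v ∈ Ω) (hint : 1 ≤ ∫ t in (0 : ℝ)..l, ρ (t • v)) :
    ∃ x ∈ Ω, radialStretch ρ x = v := by
  have hcont : ContinuousOn (fun l => ∫ t in (0 : ℝ)..l, ρ (t • v)) (Icc 0 l) := by
    have := (continuousOn_comp_smul_Icc hΩ hρ hlv).integrableOn_Icc
      (μ := MeasureTheory.volume)
    rw [← uIcc_of_le hl] at this ⊢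
    exact intervalIntegral.continuousOn_primitive_interval this
  obtain ⟨l', hl', h : ∫ t in (0 : ℝ)..l', ρ (t • v) = 1⟩ :=
    intermediate_value_Icc hl hcont (show (1 : ℝ) ∈ _ from ⟨by simp, hint⟩)
  refine ⟨l' • v, smul_mem_of_smul_mem hΩ hlv hl', ?_⟩
  rw [radialStretch, smul_smul, mul_comm, mul_segmentMean_smul, h, one_smul]

theorem exists_bijOn_univ_of_starConvex [FiniteDimensional ℝ E] (hΩo : IsOpen Ω)
    (h0 : (0 : E) ∈ Ω) (hΩ : StarConvex ℝ 0 Ω) :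
    ∃ θ : E → E, θ 0 = 0 ∧ (∀ x ∈ Ω, IsLocalDiffeomorphAt 𝓘(ℝ, E) 𝓘(ℝ, E) ∞ θ x) ∧
      BijOn θ Ω univ := by
  obtain ⟨φ, hsupp, hφ, hrange⟩ := hΩo.exists_contDiff_support_eq (n := ⊤)
  have hφ01 (x : E) : φ x ∈ Icc 0 1 := hrange ⟨x, rfl⟩
  have hφpos (x : E) (hx : x ∈ Ω) : 0 < φ x :=
    (hφ01 x).1.lt_of_ne' (hsupp.ge hx)
  let ρ : E → ℝ := fun x => (φ x ^ 2)⁻¹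
  have hpos (x : E) (hx : x ∈ Ω) : 0 < ρ x := inv_pos.2 (pow_pos (hφpos x hx) 2)
  have hρ : ContDiffOn ℝ ∞ ρ Ω :=
    (hφ.pow 2).contDiffOn.inv fun x hx => (pow_pos (hφpos x hx) 2).ne'
  refine ⟨radialStretch ρ, radialStretch_zero ρ,
    fun x hx => isLocalDiffeomorphAt_radialStretch hΩo hΩ hρ hpos hx, mapsTo_univ _ _,
    injOn_radialStretch hΩ hρ.continuousOn hpos, fun v _ => ?_⟩
  by_cases hray : (1 : ℝ) • v ∈ Ω
  · refine exists_radialStretch_eq hΩ hρ.continuousOn zero_le_one hray ?_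
    calc (1 : ℝ) = ∫ _t in (0 : ℝ)..1, 1 := by simp
      _ ≤ ∫ t in (0 : ℝ)..1, ρ (t • v) :=
        intervalIntegral.integral_mono_on zero_le_one intervalIntegrable_const
          ((continuousOn_comp_smul_Icc hΩ hρ.continuousOn hray).intervalIntegrable_of_Icc
            zero_le_one) fun t ht => (one_le_inv₀ (pow_pos (hφpos _ (hΩ.smul_mem
              (by simpa using hray) ht.1 ht.2)) 2)).2 (pow_le_one₀ (hφ01 _).1 (hφ01 _).2)
  · -- `φ` vanishes at the exit time `b`, so `(φ ^ 2)⁻¹` has infinite integral on `[0, b)`.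
    obtain ⟨b, hb, hbv, hlt⟩ := exists_exit_time hΩo h0 zero_le_one hray
    have hφv : ContDiff ℝ ∞ fun t : ℝ => φ (t • v) := hφ.comp (contDiff_id.smul contDiff_const)
    obtain ⟨l, hl, hint⟩ := one_le_integral_inv_sq_near_zero hb hφv.continuous.continuousOn
      (fun t ht => hφpos _ (hlt t ht)) (Function.notMem_support.1 (hsupp ▸ hbv))
      (hφv.differentiable (by simp) b)
    exact exists_radialStretch_eq hΩ hρ.continuousOn hl.1 (hlt l hl) hint

end StarShaped

section SubmersionNormalForm

open Set

variable {A B E : Type*} [NormedAddCommGroup A] [NormedSpace ℝ A] [NormedAddCommGroup B]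
  [NormedSpace ℝ B] [NormedAddCommGroup E] [NormedSpace ℝ E]
  {M : Type*} [TopologicalSpace M] [ChartedSpace B M] [IsManifold 𝓘(ℝ, B) ∞ M]
  {G : Type*} [TopologicalSpace G] [ChartedSpace E G] [IsManifold 𝓘(ℝ, E) ∞ G]
  {s : G → M} {g₀ : G}

theorem exists_partialDiffeomorph_fst_eq_of_isSubmersionAt
    (h : Manifold.IsSubmersionAtOfComplement A 𝓘(ℝ, E) 𝓘(ℝ, B) ∞ s g₀) :
    ∃ (φ : PartialDiffeomorph 𝓘(ℝ, E) 𝓘(ℝ, E) G E ∞) (ψ : PartialDiffeomorph 𝓘(ℝ, B) 𝓘(ℝ, B) M B ∞)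
      (L : E ≃L[ℝ] B × A), g₀ ∈ φ.source ∧
      ∀ g ∈ φ.source, s g ∈ ψ.source ∧ (L (φ g)).1 = ψ (s g) := by
  refine ⟨chartPartialDiffeomorph _ h.domChart_mem_maximalAtlas,
    chartPartialDiffeomorph _ h.codChart_mem_maximalAtlas, h.equiv, h.mem_domChart_source,
    fun g hg => ⟨h.source_subset_preimage_source hg, ?_⟩⟩
  have hmem : h.domChart g ∈ (h.domChart.extend 𝓘(ℝ, E)).target := by
    rw [OpenPartialHomeomorph.extend_target]
    exact ⟨h.domChart.map_source hg, h.domChart g, rfl⟩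
  have hleft : h.domChart.symm (h.domChart g) = g := h.domChart.left_inv hg
  have hcharts : h.codChart (s g) = (h.equiv (h.domChart g)).1 := by
    simpa [hleft] using h.writtenInCharts hmem
  exact hcharts.symm

theorem exists_partialDiffeomorph_snd_eq_of_isSubmersion
    (hs : Manifold.IsSubmersionOfComplement A 𝓘(ℝ, E) 𝓘(ℝ, B) ∞ s)
    (c : PartialDiffeomorph 𝓘(ℝ, B) 𝓘(ℝ, B) M B ∞) (hg₀ : s g₀ ∈ c.source) :
    ∃ e : PartialDiffeomorph 𝓘(ℝ, E) 𝓘(ℝ, A × B) G (A × B) ∞, g₀ ∈ e.source ∧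
      ∀ g ∈ e.source, s g ∈ c.source ∧ (e g).2 = c (s g) := by
  obtain ⟨φ, ψ, L, hφ, hL⟩ := exists_partialDiffeomorph_fst_eq_of_isSubmersionAt (hs g₀)
  have hψ (g : G) (hg : g ∈ φ.source) : ψ.symm (L (φ g)).1 = s g := by
    rw [(hL g hg).2]
    exact ψ.left_inv (hL g hg).1
  have hchange : IsLocalDiffeomorphAt 𝓘(ℝ, B) 𝓘(ℝ, B) ∞ (c ∘ ψ.symm) (L (φ g₀)).1 := by
    refine (ψ.symm.isLocalDiffeomorphAt _ _ _ ?_).comp 𝓘(ℝ, B) _ ?_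
    · rw [(hL g₀ hφ).2]
      exact ψ.map_source (hL g₀ hφ).1
    · rw [hψ g₀ hφ]
      exact c.isLocalDiffeomorphAt _ _ _ hg₀
  have hf : IsLocalDiffeomorphAt 𝓘(ℝ, E) 𝓘(ℝ, A × B) ∞
      (fun g => ((L (φ g)).2, c (ψ.symm (L (φ g)).1))) g₀ :=
    (((((φ.isLocalDiffeomorphAt _ _ _ hφ).comp _ _ (L.toDiffeomorph.isLocalDiffeomorph _)).comp
      _ _ ((prodSelfDiffeomorph B A).isLocalDiffeomorph _)).comp _ _
      (isLocalDiffeomorphAt_prodMap hchange (isLocalDiffeomorphAt_id _))).comp _ _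
      ((Diffeomorph.prodComm 𝓘(ℝ, B) 𝓘(ℝ, A) B A ∞).isLocalDiffeomorph _)).comp _ _
      ((prodSelfDiffeomorph A B).symm.isLocalDiffeomorph _)
  obtain ⟨Φ, hΦ, hfΦ⟩ := hf
  refine ⟨restrictPartialDiffeomorph Φ (φ.source ∩ s ⁻¹' c.source)
    (φ.open_source.inter (c.open_source.preimage hs.contMDiff.continuous)), ⟨hΦ, hφ, hg₀⟩,
    fun g hg => ⟨hg.2.2, (congrArg Prod.snd (hfΦ hg.1)).symm.trans ?_⟩⟩
  exact congrArg c (hψ g hg.2.1)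

end SubmersionNormalForm

section SliceCharts

open Set

variable {A B E : Type*} [NormedAddCommGroup A] [NormedSpace ℝ A] [NormedAddCommGroup B]
  [NormedSpace ℝ B] [NormedAddCommGroup E] [NormedSpace ℝ E]
  {G : Type*} [TopologicalSpace G] [ChartedSpace E G] {K : Type*} {ι : K → G} {π : G → B}

variable (A E) in
/-- A chart of `G` with values in `A × B` whose second component is `π : G → B`, and in which the
range of `ι : K → G` is the zero locus of `π`. It serves to make `K` a submanifold of `G` modelled
on `A`. -/
structure SliceChart (ι : K → G) (π : G → B) extends
    PartialDiffeomorph 𝓘(ℝ, E) 𝓘(ℝ, A × B) G (A × B) ∞ where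
  snd_eq : ∀ g ∈ source, (toFun g).2 = π g
  mem_range_iff : ∀ g ∈ source, g ∈ range ι ↔ π g = 0

namespace SliceChart

instance : CoeFun (SliceChart A E ι π) fun _ => G → A × B := ⟨fun σ => σ.toFun⟩

/-- The local parametrisation of `G` inverse to a slice chart. -/
def param (σ : SliceChart A E ι π) : A × B → G := σ.invFun

variable (σ : SliceChart A E ι π)

theorem contMDiffOn : ContMDiffOn 𝓘(ℝ, E) 𝓘(ℝ, A × B) ∞ σ σ.source := σ.contMDiffOn_toFun

theorem contMDiffOn_param : ContMDiffOn 𝓘(ℝ, A × B) 𝓘(ℝ, E) ∞ σ.param σ.target :=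
  σ.contMDiffOn_invFun

theorem param_apply {g : G} (hg : g ∈ σ.source) : σ.param (σ g) = g := σ.left_inv hg

theorem apply_param {p : A × B} (hp : p ∈ σ.target) : σ (σ.param p) = p := σ.right_inv hp

theorem param_mem {p : A × B} (hp : p ∈ σ.target) : σ.param p ∈ σ.source := σ.map_target hp

theorem apply_ι {h : K} (hh : ι h ∈ σ.source) : σ (ι h) = ((σ (ι h)).1, 0) :=
  Prod.ext rfl ((σ.snd_eq _ hh).trans ((σ.mem_range_iff _ hh).1 (mem_range_self h)))

theorem param_mem_range {a : A} (ha : (a, (0 : B)) ∈ σ.target) : σ.param (a, 0) ∈ range ι := by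
  rw [σ.mem_range_iff _ (σ.param_mem ha), ← σ.snd_eq _ (σ.param_mem ha)]
  exact congrArg Prod.snd (σ.apply_param ha)

variable [TopologicalSpace K] (hι : Topology.IsEmbedding ι)

/-- The chart of `K` induced by a slice chart. -/
noncomputable def chart [Nonempty K] : OpenPartialHomeomorph K A where
  toFun h := (σ (ι h)).1
  invFun a := Function.invFun ι (σ.param (a, 0))
  source := ι ⁻¹' σ.source
  target := {a | (a, 0) ∈ σ.target}
  map_source' h hh := by
    change ((σ (ι h)).1, (0 : B)) ∈ σ.target
    rw [← σ.apply_ι hh]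
    exact σ.map_source hh
  map_target' a ha := by
    rw [mem_preimage, Function.invFun_eq (σ.param_mem_range ha)]
    exact σ.param_mem ha
  left_inv' h hh := by
    rw [← σ.apply_ι hh, σ.param_apply hh, Function.leftInverse_invFun hι.injective]
  right_inv' a ha := by rw [Function.invFun_eq (σ.param_mem_range ha), σ.apply_param ha]
  open_source := σ.open_source.preimage hι.continuous
  open_target := σ.open_target.preimage (by fun_prop)
  continuousOn_toFun := continuous_fst.comp_continuousOn
    (σ.contMDiffOn.continuousOn.comp hι.continuous.continuousOn fun _ h => h)
  continuousOn_invFun := by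
    rw [hι.continuousOn_iff]
    exact (σ.contMDiffOn_param.continuousOn.comp (f := fun a => (a, (0 : B))) (by fun_prop)
      fun _ h => h).congr fun a ha => Function.invFun_eq (σ.param_mem_range ha)

theorem ι_chart_symm [Nonempty K] {a : A} (ha : a ∈ (σ.chart hι).target) :
    ι ((σ.chart hι).symm a) = σ.param (a, 0) :=
  Function.invFun_eq (σ.param_mem_range ha)

theorem contDiffOn_chart_trans [Nonempty K] (σ' : SliceChart A E ι π) :
    ContDiffOn ℝ ∞ (σ'.chart hι ∘ (σ.chart hι).symm)
      ((σ.chart hι).symm ≫ₕ σ'.chart hι).source := by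
  rw [← contMDiffOn_iff_contDiffOn]
  have hcomp : ContMDiffOn 𝓘(ℝ, A) 𝓘(ℝ, A) ∞ (fun a : A => (σ' (σ.param (a, 0))).1)
      ((σ.chart hι).symm ≫ₕ σ'.chart hι).source := by
    refine contDiff_fst.contMDiff.comp_contMDiffOn (σ'.contMDiffOn.comp
      (σ.contMDiffOn_param.comp (f := fun a : A => (a, (0 : B)))
        (ContDiff.contMDiff (by fun_prop)).contMDiffOn fun a ha => ha.1) fun a ha => ?_)
    have hmem : ι ((σ.chart hι).symm a) ∈ σ'.source := ha.2
    rwa [ι_chart_symm _ _ ha.1] at hmem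
  refine hcomp.congr fun a ha => ?_
  exact congrArg (fun g => (σ' g).1) (ι_chart_symm _ _ ha.1)

variable (σ : K → SliceChart A E ι π) (hσ : ∀ h, ι h ∈ (σ h).source)

/-- The structure of charted space on an embedded space given by slice charts around its points. -/
@[reducible] noncomputable def chartedSpace : ChartedSpace A K where
  atlas := range fun h => haveI : Nonempty K := ⟨h⟩; (σ h).chart hι
  chartAt h := haveI : Nonempty K := ⟨h⟩; (σ h).chart hι
  mem_chart_source h := hσ h
  chart_mem_atlas h := ⟨h, rfl⟩

theorem isManifold : letI := chartedSpace hι σ hσ; IsManifold 𝓘(ℝ, A) ∞ K := by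
  let _ := chartedSpace hι σ hσ
  refine isManifold_of_contDiffOn _ _ _ ?_
  rintro e e' ⟨h, rfl⟩ ⟨h', rfl⟩
  have : Nonempty K := ⟨h⟩
  simpa using (σ h).contDiffOn_chart_trans hι (σ h')

theorem contMDiffAt_of_comp {E' H N : Type*} [NormedAddCommGroup E'] [NormedSpace ℝ E']
    [TopologicalSpace H] {I : ModelWithCorners ℝ E' H} [TopologicalSpace N] [ChartedSpace H N]
    {f : N → K} {p : N} (hf : ContMDiffAt I 𝓘(ℝ, E) ∞ (ι ∘ f) p) :
    letI := chartedSpace hι σ hσ; ContMDiffAt I 𝓘(ℝ, A) ∞ f p := by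
  let _ := chartedSpace hι σ hσ
  refine contMDiffAt_iff_target.2 ⟨hι.continuousAt_iff.2 hf.continuousAt, ?_⟩
  exact contDiff_fst.contMDiff.contMDiffAt.comp p
    (((σ (f p)).contMDiffOn.contMDiffAt ((σ (f p)).open_source.mem_nhds (hσ _))).comp p hf)

theorem isImmersion [IsManifold 𝓘(ℝ, E) ∞ G] (L : (A × B) ≃L[ℝ] E) :
    letI := chartedSpace hι σ hσ; Manifold.IsImmersionOfComplement B 𝓘(ℝ, A) 𝓘(ℝ, E) ∞ ι := by
  let _ := chartedSpace hι σ hσ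
  have := isManifold hι σ hσ
  intro h
  have : Nonempty K := ⟨h⟩
  let e : OpenPartialHomeomorph G E :=
    (σ h).toOpenPartialHomeomorph.transHomeomorph L.toHomeomorph
  have he : e ∈ IsManifold.maximalAtlas 𝓘(ℝ, E) ∞ G :=
    e.mem_maximalAtlas_of_contMDiffOn (L.contDiff.contMDiff.comp_contMDiffOn (σ h).contMDiffOn)
      ((σ h).contMDiffOn_param.comp L.symm.contDiff.contMDiff.contMDiffOn fun y hy => hy)
  refine Manifold.IsImmersionAtOfComplement.mk_of_continuousAt hι.continuous.continuousAt L
    (chartAt A h) e (mem_chart_source A h) (hσ h) (IsManifold.chart_mem_maximalAtlas h) he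
    fun a ha => ?_
  have ha' : a ∈ ((σ h).chart hι).target := by
    rw [OpenPartialHomeomorph.extend_target] at ha
    exact ha.1
  change L (σ h (ι (((σ h).chart hι).symm a))) = L (a, 0)
  rw [ι_chart_symm _ _ ha', apply_param _ ha']

end SliceChart

end SliceCharts

section Retractions

open Set

variable {A E : Type*} [NormedAddCommGroup A] [NormedSpace ℝ A] [NormedAddCommGroup E]
  [NormedSpace ℝ E] {K : Type*} [TopologicalSpace K] [ChartedSpace A K]

theorem exists_contMDiffOn_contraction [IsManifold 𝓘(ℝ, A) ∞ K] (p : K) :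
    ∃ (S : Set K) (m : ℝ × K → K), IsOpen S ∧ p ∈ S ∧
      ContMDiffOn (𝓘(ℝ, ℝ).prod 𝓘(ℝ, A)) 𝓘(ℝ, A) ∞ m (Icc 0 1 ×ˢ S) ∧
      (∀ q ∈ S, m (0, q) = p) ∧ (∀ q ∈ S, m (1, q) = q) ∧ ∀ t, m (t, p) = p := by
  let c := chartAt A p
  have hleft (q : K) (hq : q ∈ c.source) : c.symm (c q) = q := c.left_inv hq
  have hp : p ∈ c.source := mem_chart_source A p
  obtain ⟨ε, hε, hball⟩ := Metric.isOpen_iff.1 c.open_target (c p) (mem_chart_target A p)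
  refine ⟨c.source ∩ c ⁻¹' Metric.ball (c p) ε,
    fun tq => c.symm (c p + tq.1 • (c tq.2 - c p)), c.isOpen_inter_preimage Metric.isOpen_ball,
    ⟨hp, Metric.mem_ball_self hε⟩, ?_, fun q _ => by simp [hleft p hp],
    fun q hq => by simp [hleft q hq.1], fun t => by simp [hleft p hp]⟩
  refine (contMDiffOn_chart_symm (x := p)).comp ?_ fun tq htq => hball ?_
  · exact contMDiffOn_const.add (contMDiffOn_fst.smul
      (((contMDiffOn_chart (x := p)).comp contMDiffOn_snd fun tq htq => htq.2.1).sub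
        contMDiffOn_const))
  · have hdist : ‖c tq.2 - c p‖ < ε := mem_ball_iff_norm.1 htq.2.2
    rw [mem_ball_iff_norm, add_sub_cancel_left, norm_smul, Real.norm_of_nonneg htq.1.1]
    exact (mul_le_of_le_one_left (norm_nonneg _) htq.1.2).trans_lt hdist

variable {G : Type*} [TopologicalSpace G] [ChartedSpace E G] {ι : K → G}

variable (A E) in
/-- `r` is a smooth retraction, along `ι : K → G`, of the open set `V ⊆ G` to its part in `K`. -/
structure IsRetractionOn (ι : K → G) (r : G → K) (V : Set G) : Prop where
  isOpen : IsOpen V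
  contMDiffOn : ContMDiffOn 𝓘(ℝ, E) 𝓘(ℝ, A) ∞ r V
  apply_eq : ∀ h, ι h ∈ V → r (ι h) = h

namespace IsRetractionOn

variable {r r₀ r₁ : G → K} {V V₀ V₁ : Set G}

theorem mono (h : IsRetractionOn A E ι r V₁) (hV : V₀ ⊆ V₁) (hV₀ : IsOpen V₀) :
    IsRetractionOn A E ι r V₀ :=
  ⟨hV₀, h.contMDiffOn.mono hV, fun k hk => h.apply_eq k (hV hk)⟩

theorem exists_union_of_eqOn (h₀ : IsRetractionOn A E ι r₀ V₀) (h₁ : IsRetractionOn A E ι r₁ V₁)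
    (heq : EqOn r₀ r₁ (V₀ ∩ V₁)) :
    ∃ r, IsRetractionOn A E ι r (V₀ ∪ V₁) ∧ EqOn r r₀ V₀ ∧ EqOn r r₁ V₁ := by
  classical
  have hr₀ : EqOn (V₀.piecewise r₀ r₁) r₀ V₀ := piecewise_eqOn V₀ r₀ r₁
  have hr₁ : EqOn (V₀.piecewise r₀ r₁) r₁ V₁ := by
    intro g hg
    by_cases hg₀ : g ∈ V₀
    · exact (hr₀ hg₀).trans (heq ⟨hg₀, hg⟩)
    · exact piecewise_eq_of_notMem _ _ _ hg₀
  refine ⟨V₀.piecewise r₀ r₁, ⟨h₀.isOpen.union h₁.isOpen, (h₀.contMDiffOn.congr hr₀).union_of_isOpen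
    (h₁.contMDiffOn.congr hr₁) h₀.isOpen h₁.isOpen, ?_⟩, hr₀, hr₁⟩
  rintro k (hk | hk)
  · rw [hr₀ hk, h₀.apply_eq k hk]
  · rw [hr₁ hk, h₁.apply_eq k hk]

variable [Group K] [LieGroup 𝓘(ℝ, A) ∞ K]

theorem exists_interpolation (h₀ : IsRetractionOn A E ι r₀ V₀) (h₁ : IsRetractionOn A E ι r₁ V₁)
    {χ : G → ℝ} (hχ : ContMDiff 𝓘(ℝ, E) 𝓘(ℝ, ℝ) ∞ χ) (hχI : ∀ g, χ g ∈ Icc 0 1) :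
    ∃ r D, IsRetractionOn A E ι r D ∧ (∀ k, ι k ∈ V₀ ∩ V₁ → ι k ∈ D) ∧
      (∀ g ∈ D, χ g = 0 → r g = r₀ g) ∧ ∀ g ∈ D, χ g = 1 → r g = r₁ g := by
  obtain ⟨S, m, hS, h1S, hm, hm0, hm1, hm_one⟩ :=
    exists_contMDiffOn_contraction (A := A) (1 : K)
  let q : G → K := fun g => (r₀ g)⁻¹ * r₁ g
  have hq : ContMDiffOn 𝓘(ℝ, E) 𝓘(ℝ, A) ∞ q (V₀ ∩ V₁) :=
    (h₀.contMDiffOn.mono inter_subset_left).inv.mul (h₁.contMDiffOn.mono inter_subset_right)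
  have hq_one (k : K) (hk : ι k ∈ V₀ ∩ V₁) : q (ι k) = 1 := by
    simp [q, h₀.apply_eq k hk.1, h₁.apply_eq k hk.2]
  let D : Set G := (V₀ ∩ V₁) ∩ q ⁻¹' S
  refine ⟨fun g => r₀ g * m (χ g, q g), D,
    ⟨hq.continuousOn.isOpen_inter_preimage (h₀.isOpen.inter h₁.isOpen) hS, ?_, ?_⟩, ?_, ?_, ?_⟩
  · exact (h₀.contMDiffOn.mono fun g hg => hg.1.1).mul
      (hm.comp (hχ.contMDiffOn.prodMk (hq.mono inter_subset_left)) fun g hg => ⟨hχI g, hg.2⟩)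
  · intro k hk
    rw [hq_one k hk.1, hm_one, mul_one, h₀.apply_eq k hk.1.1]
  · exact fun k hk => ⟨hk, by rwa [mem_preimage, hq_one k hk]⟩
  · intro g hg hg0
    change r₀ g * m (χ g, q g) = r₀ g
    rw [hg0, hm0 _ hg.2, mul_one]
  · intro g hg hg1
    change r₀ g * m (χ g, q g) = r₁ g
    rw [hg1, hm1 _ hg.2, mul_inv_cancel_left]

theorem exists_union_of_isCompact [FiniteDimensional ℝ E] [IsManifold 𝓘(ℝ, E) ∞ G] [T2Space G]
    [NormalSpace G] [SigmaCompactSpace G] (hι : Continuous ι)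
    (h₀ : IsRetractionOn A E ι r₀ V₀) (h₁ : IsRetractionOn A E ι r₁ V₁)
    {C₀ C₁ : Set K} (hC₀ : IsCompact C₀) (hC₁ : IsCompact C₁) (hV₀ : MapsTo ι C₀ V₀)
    (hV₁ : MapsTo ι C₁ V₁) :
    ∃ r V, IsRetractionOn A E ι r V ∧ MapsTo ι (C₀ ∪ C₁) V := by
  let F₀ := ι '' (C₀ \ ι ⁻¹' V₁)
  let F₁ := ι '' (C₁ \ ι ⁻¹' V₀)
  have hF₀ : IsClosed F₀ := ((hC₀.diff (h₁.isOpen.preimage hι)).image hι).isClosed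
  have hF₁ : IsClosed F₁ := ((hC₁.diff (h₀.isOpen.preimage hι)).image hι).isClosed
  have hdisj : Disjoint F₀ F₁ := by
    rw [disjoint_left]
    rintro _ ⟨k, hk, rfl⟩ ⟨k', hk', he⟩
    have hk₀ : ι k' ∈ V₀ := he ▸ hV₀ hk.1
    exact hk'.2 hk₀
  obtain ⟨χ, hχ0, hχ1, hχ⟩ := exists_contMDiffMap_zero_one_nhds_of_isClosed (n := ⊤) 𝓘(ℝ, E)
    hF₀ hF₁ hdisj
  obtain ⟨Z₀, hZ₀, hFZ₀, hχZ₀⟩ := mem_nhdsSet_iff_exists.1 hχ0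
  obtain ⟨Z₁, hZ₁, hFZ₁, hχZ₁⟩ := mem_nhdsSet_iff_exists.1 hχ1
  obtain ⟨p, D, hp, hD, hp₀, hp₁⟩ := h₀.exists_interpolation h₁ χ.contMDiff hχ
  obtain ⟨p', hp', hp'p, -⟩ := hp.exists_union_of_eqOn
    (h₀.mono inter_subset_left (h₀.isOpen.inter hZ₀)) fun g hg => hp₀ g hg.1 (hχZ₀ hg.2.2)
  have hp'₁ : EqOn p' r₁ ((D ∪ V₀ ∩ Z₀) ∩ (V₁ ∩ Z₁)) := by
    rintro g ⟨hg | hg, hg₁⟩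
    · exact (hp'p hg).trans (hp₁ g hg (hχZ₁ hg₁.2))
    · exact absurd ((hχZ₀ hg.2).symm.trans (hχZ₁ hg₁.2)) zero_ne_one
  obtain ⟨r, hr, -⟩ := hp'.exists_union_of_eqOn
    (h₁.mono inter_subset_left (h₁.isOpen.inter hZ₁)) hp'₁
  refine ⟨r, _, hr, fun k hk => ?_⟩
  by_cases hk₀ : ι k ∈ V₀ <;> by_cases hk₁ : ι k ∈ V₁
  · exact .inl (.inl (hD k ⟨hk₀, hk₁⟩))
  · have hkC : k ∈ C₀ := hk.resolve_right fun hkC => hk₁ (hV₁ hkC)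
    exact .inl (.inr ⟨hk₀, hFZ₀ ⟨k, ⟨hkC, hk₁⟩, rfl⟩⟩)
  · have hkC : k ∈ C₁ := hk.resolve_left fun hkC => hk₀ (hV₀ hkC)
    exact .inr ⟨hk₁, hFZ₁ ⟨k, ⟨hkC, hk₀⟩, rfl⟩⟩
  · exact (hk.elim (fun hkC => hk₀ (hV₀ hkC)) fun hkC => hk₁ (hV₁ hkC)).elim

theorem exists_of_compactSpace [FiniteDimensional ℝ E] [IsManifold 𝓘(ℝ, E) ∞ G] [T2Space G]
    [NormalSpace G] [SigmaCompactSpace G] [CompactSpace K] [T2Space K] (hι : Continuous ι)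
    (hloc : ∀ k, ∃ r V, IsRetractionOn A E ι r V ∧ ι k ∈ V) :
    ∃ r V, IsRetractionOn A E ι r V ∧ ∀ k, ι k ∈ V := by
  suffices ∃ r V, IsRetractionOn A E ι r V ∧ MapsTo ι (closure univ) V by
    simpa [MapsTo] using this
  refine isCompact_univ.induction_on
    (p := fun C => ∃ r V, IsRetractionOn A E ι r V ∧ MapsTo ι (closure C) V) ?_ ?_ ?_ ?_
  · obtain ⟨r, V, hr, -⟩ := hloc 1
    exact ⟨r, V, hr, by simp [MapsTo]⟩
  · rintro C C' hCC' ⟨r, V, hr, hV⟩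
    exact ⟨r, V, hr, hV.mono_left (closure_mono hCC')⟩
  · rintro C C' ⟨r, V, hr, hV⟩ ⟨r', V', hr', hV'⟩
    rw [closure_union]
    exact hr.exists_union_of_isCompact hι hr' isClosed_closure.isCompact
      isClosed_closure.isCompact hV hV'
  · intro k _
    obtain ⟨r, V, hr, hV⟩ := hloc k
    obtain ⟨C, hC, hC_closed, hCV⟩ := exists_mem_nhds_isClosed_subset
      ((hr.isOpen.preimage hι).mem_nhds hV)
    refine ⟨C, mem_nhdsWithin_of_mem_nhds hC, r, V, hr, ?_⟩
    rw [hC_closed.closure_eq]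
    exact hCV

theorem inv_comp_mul (h : IsRetractionOn A E ι r V) {e : G → G}
    (he : ContMDiff 𝓘(ℝ, E) 𝓘(ℝ, E) ∞ e) (heι : ∀ k, e (ι k) = ι 1) :
    IsRetractionOn A E ι (fun g => (r (e g))⁻¹ * r g) (V ∩ e ⁻¹' V) := by
  refine ⟨h.isOpen.inter (h.isOpen.preimage he.continuous),
    (h.contMDiffOn.comp he.contMDiffOn fun g hg => hg.2).inv.mul
      (h.contMDiffOn.mono inter_subset_left), fun k hk => ?_⟩
  have h1 : ι 1 ∈ V := heι k ▸ hk.2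
  rw [heι, h.apply_eq 1 h1, h.apply_eq k hk.1, inv_one, one_mul]

end IsRetractionOn

variable {B : Type*} [NormedAddCommGroup B] [NormedSpace ℝ B] {π : G → B}
  {σ : SliceChart A E ι π} {φ : PartialDiffeomorph 𝓘(ℝ, A) 𝓘(ℝ, A) K A ∞}

/-- The slice chart `σ` of `G` restricts along `ι : K → G` to the chart `φ` of `K`. -/
structure SliceChart.IsAdaptedTo (σ : SliceChart A E ι π)
    (φ : PartialDiffeomorph 𝓘(ℝ, A) 𝓘(ℝ, A) K A ∞) : Prop where
  source_eq : φ.source = ι ⁻¹' σ.source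
  fst_eq : ∀ k ∈ φ.source, (σ (ι k)).1 = φ k

namespace SliceChart.IsAdaptedTo

theorem apply_ι (hσ : σ.IsAdaptedTo φ) {k : K} (hk : k ∈ φ.source) : σ (ι k) = (φ k, 0) := by
  have hkσ : ι k ∈ σ.source := by rwa [hσ.source_eq] at hk
  rw [σ.apply_ι hkσ, hσ.fst_eq k hk]

theorem isRetractionOn (hσ : σ.IsAdaptedTo φ) :
    IsRetractionOn A E ι (fun g => φ.symm (σ g).1)
      (σ.source ∩ (fun g => (σ g).1) ⁻¹' φ.target) := by
  have hfst : ContMDiffOn 𝓘(ℝ, E) 𝓘(ℝ, A) ∞ (fun g => (σ g).1) σ.source :=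
    contDiff_fst.contMDiff.comp_contMDiffOn σ.contMDiffOn
  refine ⟨hfst.continuousOn.isOpen_inter_preimage σ.open_source φ.open_target,
    φ.contMDiffOn_invFun.comp (hfst.mono inter_subset_left) fun g hg => hg.2, fun k hk => ?_⟩
  have hkφ : k ∈ φ.source := by rw [hσ.source_eq]; exact hk.1
  rw [hσ.fst_eq k hkφ]
  exact φ.left_inv hkφ

theorem mem_isRetractionOn (hσ : σ.IsAdaptedTo φ) {k : K} (hk : k ∈ φ.source) :
    ι k ∈ σ.source ∩ (fun g => (σ g).1) ⁻¹' φ.target := by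
  refine ⟨by rwa [hσ.source_eq] at hk, ?_⟩
  rw [mem_preimage, hσ.fst_eq k hk]
  exact φ.map_source hk

theorem isLocalDiffeomorphAt_inCharts [CompleteSpace A] [CompleteSpace B] (hσ : σ.IsAdaptedTo φ)
    {k : K} (hk : k ∈ φ.source) {r : G → K} {V : Set G} (hr : IsRetractionOn A E ι r V)
    (hV : ι k ∈ V) :
    IsLocalDiffeomorphAt 𝓘(ℝ, A × B) 𝓘(ℝ, A × B) ∞ (fun p => (φ (r (σ.param p)), p.2))
      (φ k, 0) := by
  have hkσ : ι k ∈ σ.source := by rwa [hσ.source_eq] at hk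
  have hparam : σ.param (φ k, 0) = ι k := by rw [← hσ.apply_ι hk, σ.param_apply hkσ]
  let W : Set G := V ∩ r ⁻¹' φ.source
  have hW : IsOpen W := hr.contMDiffOn.continuousOn.isOpen_inter_preimage hr.isOpen φ.open_source
  let O : Set (A × B) := σ.target ∩ σ.param ⁻¹' W
  have hO : IsOpen O :=
    σ.contMDiffOn_param.continuousOn.isOpen_inter_preimage σ.open_target hW
  have hkO : (φ k, (0 : B)) ∈ O := by
    refine ⟨?_, ?_⟩
    · rw [← hσ.apply_ι hk]
      exact σ.map_source hkσ
    · rw [mem_preimage, hparam]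
      exact ⟨hV, by rwa [mem_preimage, hr.apply_eq k hV]⟩
  have hF : ContMDiffOn 𝓘(ℝ, A × B) 𝓘(ℝ, A) ∞ (fun p => φ (r (σ.param p))) O :=
    φ.contMDiffOn_toFun.comp (hr.contMDiffOn.comp (σ.contMDiffOn_param.mono inter_subset_left)
      fun p hp => hp.2.1) fun p hp => hp.2.2
  refine isLocalDiffeomorphAt_prodMk_snd ?_ ?_
  · filter_upwards [hO.mem_nhds hkO] with p hp
    exact (contMDiffOn_iff_contDiffOn.1 hF).contDiffAt (hO.mem_nhds hp)
  · have hcont : ContinuousAt (fun a : A => (a, (0 : B))) (φ k) := by fun_prop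
    filter_upwards [hcont.preimage_mem_nhds (hO.mem_nhds hkO)] with a ha
    obtain ⟨k', hk'⟩ := σ.param_mem_range ha.1
    have hk'φ : k' ∈ φ.source := by
      rw [hσ.source_eq, mem_preimage, hk']
      exact σ.param_mem ha.1
    have hk'V : ι k' ∈ V := hk' ▸ ha.2.1
    rw [← hk', hr.apply_eq k' hk'V, ← hσ.fst_eq k' hk'φ, hk', σ.apply_param ha.1]

theorem isLocalDiffeomorphAt_prodMk [CompleteSpace A] [CompleteSpace B] (hσ : σ.IsAdaptedTo φ)
    {k : K} (hk : k ∈ φ.source) {r : G → K} {V : Set G} (hr : IsRetractionOn A E ι r V)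
    (hV : ι k ∈ V) :
    IsLocalDiffeomorphAt 𝓘(ℝ, E) (𝓘(ℝ, A).prod 𝓘(ℝ, B)) ∞ (fun g => (r g, π g)) (ι k) := by
  have hkσ : ι k ∈ σ.source := by rwa [hσ.source_eq] at hk
  have hφr : φ (r (ι k)) ∈ φ.target := by
    rw [hr.apply_eq k hV]
    exact φ.map_source hk
  have hlocal : IsLocalDiffeomorphAt 𝓘(ℝ, E) (𝓘(ℝ, A).prod 𝓘(ℝ, B)) ∞
      (fun g => (φ.symm (φ (r (σ.param (σ g)))), (σ g).2)) (ι k) := by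
    refine (((σ.isLocalDiffeomorphAt _ _ _ hkσ).comp 𝓘(ℝ, A × B) _
      (g := fun p => (φ (r (σ.param p)), p.2)) ?_).comp _ _
      ((prodSelfDiffeomorph A B).isLocalDiffeomorph _)).comp (𝓘(ℝ, A).prod 𝓘(ℝ, B)) (K × B)
      (g := Prod.map φ.symm id)
      (isLocalDiffeomorphAt_prodMap (φ.symm.isLocalDiffeomorphAt _ _ _ ?_)
        (isLocalDiffeomorphAt_id _))
    · change IsLocalDiffeomorphAt _ _ _ _ (σ (ι k))
      rw [hσ.apply_ι hk]
      exact hσ.isLocalDiffeomorphAt_inCharts hk hr hV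
    · change φ (r (σ.param (σ (ι k)))) ∈ φ.target
      rwa [σ.param_apply hkσ]
  refine isLocalDiffeomorphAt_congr hlocal ?_
  have hkr : r (ι k) ∈ φ.source := by rwa [hr.apply_eq k hV]
  filter_upwards [σ.open_source.mem_nhds hkσ,
    ((hr.contMDiffOn.continuousOn.isOpen_inter_preimage hr.isOpen φ.open_source).mem_nhds
      ⟨hV, hkr⟩)] with g hgσ hg
  rw [σ.param_apply hgσ, σ.snd_eq g hgσ]
  exact Prod.ext (φ.left_inv hg.2).symm rfl

end SliceChart.IsAdaptedTo

end Retractions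

section CalculusAlongManifold

open Filter Set

variable {A B : Type*} [NormedAddCommGroup A] [NormedAddCommGroup B] {K : Type*}
  [TopologicalSpace K] [ChartedSpace A K] {k₀ : K}

theorem tendsto_chartAt_symm : Tendsto (chartAt A k₀).symm (𝓝 (chartAt A k₀ k₀)) (𝓝 k₀) := by
  have hsymm := (chartAt A k₀).continuousAt_symm (mem_chart_target A k₀)
  rwa [ContinuousAt, (chartAt A k₀).left_inv (mem_chart_source A k₀)] at hsymm

theorem eventually_of_eventually_chartAt_symm {P : K → B → Prop}
    (hP : ∀ᶠ p in 𝓝 (chartAt A k₀ k₀, (0 : B)), P ((chartAt A k₀).symm p.1) p.2) :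
    ∀ᶠ p in 𝓝 (k₀, (0 : B)), P p.1 p.2 := by
  have hchart : Tendsto (fun p : K × B => (chartAt A k₀ p.1, p.2)) (𝓝 (k₀, 0))
      (𝓝 (chartAt A k₀ k₀, 0)) :=
    (((chartAt A k₀).continuousAt (mem_chart_source A k₀)).comp continuousAt_fst).prodMk
      continuousAt_snd
  filter_upwards [hchart.eventually hP, continuousAt_fst.eventually
    ((chartAt A k₀).eventually_left_inverse (mem_chart_source A k₀))] with p hp hleft
  rwa [hleft] at hp

variable [NormedSpace ℝ A] [NormedSpace ℝ B] [IsManifold 𝓘(ℝ, A) ∞ K] {C : Type*}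

theorem contDiffAt_comp_chartAt_symm [NormedAddCommGroup C] [NormedSpace ℝ C] {T : K × B → C}
    (hT : ContMDiffAt (𝓘(ℝ, A).prod 𝓘(ℝ, B)) 𝓘(ℝ, C) ∞ T (k₀, 0)) :
    ContDiffAt ℝ 1 (fun p : A × B => T ((chartAt A k₀).symm p.1, p.2)) (chartAt A k₀ k₀, 0) := by
  have hleft : (chartAt A k₀).symm (chartAt A k₀ k₀) = k₀ :=
    (chartAt A k₀).left_inv (mem_chart_source A k₀)
  have hsymm : ContMDiffAt 𝓘(ℝ, A) 𝓘(ℝ, A) ∞ (chartAt A k₀).symm (chartAt A k₀ k₀) :=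
    contMDiffOn_chart_symm.contMDiffAt
      ((chartAt A k₀).open_target.mem_nhds (mem_chart_target A k₀))
  have hpair : ContMDiffAt 𝓘(ℝ, A × B) (𝓘(ℝ, A).prod 𝓘(ℝ, B)) ∞
      (fun p : A × B => ((chartAt A k₀).symm p.1, p.2)) (chartAt A k₀ k₀, 0) :=
    (hsymm.comp (f := fun p : A × B => p.1) (chartAt A k₀ k₀, (0 : B))
      contDiff_fst.contMDiff.contMDiffAt).prodMk contDiff_snd.contMDiff.contMDiffAt
  refine (contMDiffAt_iff_contDiffAt.1 (ContMDiffAt.comp (g := T) (I' := 𝓘(ℝ, A).prod 𝓘(ℝ, B))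
    (chartAt A k₀ k₀, (0 : B)) ?_ hpair)).of_le (by simp)
  rwa [hleft]

theorem exists_norm_le_mul_norm_snd_of_contMDiffAt [NormedAddCommGroup C] [NormedSpace ℝ C]
    {T : K × B → C} (hT : ContMDiffAt (𝓘(ℝ, A).prod 𝓘(ℝ, B)) 𝓘(ℝ, C) ∞ T (k₀, 0))
    (hT0 : ∀ᶠ k in 𝓝 k₀, T (k, 0) = 0) :
    ∃ L : ℝ, ∀ᶠ p in 𝓝 (k₀, (0 : B)), ‖T p‖ ≤ L * ‖p.2‖ := by
  obtain ⟨L, hL⟩ := exists_norm_le_mul_norm_snd (contDiffAt_comp_chartAt_symm hT)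
    (tendsto_chartAt_symm.eventually hT0)
  exact ⟨L, eventually_of_eventually_chartAt_symm (A := A)
    (P := fun k b => ‖T (k, b)‖ ≤ L * ‖b‖) hL⟩

theorem eventually_forall_norm_smul_snd_le_of_contMDiffAt [NormedAddCommGroup C]
    [InnerProductSpace ℝ C] {T : K × B → C}
    (hT : ContMDiffAt (𝓘(ℝ, A).prod 𝓘(ℝ, B)) 𝓘(ℝ, C) ∞ T (k₀, 0))
    (hT0 : ∀ᶠ k in 𝓝 k₀, T (k, 0) = 0) {L : ℝ}
    (hL : ∀ᶠ p in 𝓝 (k₀, (0 : B)), ‖p.2‖ ≤ L * ‖T p‖) :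
    ∀ᶠ p in 𝓝 (k₀, (0 : B)), ∀ l ∈ Icc (0 : ℝ) 1, ‖T (p.1, l • p.2)‖ ≤ ‖T p‖ := by
  have hsymm : Tendsto (fun p : A × B => ((chartAt A k₀).symm p.1, p.2))
      (𝓝 (chartAt A k₀ k₀, 0)) (𝓝 (k₀, 0)) :=
    (tendsto_chartAt_symm.comp (continuous_fst.tendsto (chartAt A k₀ k₀, (0 : B)))).prodMk_nhds
      (continuous_snd.tendsto _)
  exact eventually_of_eventually_chartAt_symm (A := A)
    (P := fun k b => ∀ l ∈ Icc (0 : ℝ) 1, ‖T (k, l • b)‖ ≤ ‖T (k, b)‖)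
    (eventually_forall_norm_smul_snd_le (contDiffAt_comp_chartAt_symm hT)
      (tendsto_chartAt_symm.eventually hT0) (hsymm.eventually hL))

end CalculusAlongManifold

namespace ProperAtPoint

open Filter Set

variable {X Y : Type*} [TopologicalSpace X] [TopologicalSpace Y] {f : X → Y} {y : Y}

theorem isCompact_preimage_singleton [TopologicalSpace.MetrizableSpace X] [T1Space Y]
    (hf : ProperAtPoint f y) (hcont : Continuous f) : IsCompact (f ⁻¹' {y}) := by
  let _ := TopologicalSpace.metrizableSpaceMetric X
  refine IsSeqCompact.isCompact fun a ha => ?_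
  obtain ⟨b, φ, hφ, hb⟩ := hf a (tendsto_const_nhds.congr fun i => (ha i).symm)
  exact ⟨b, (isClosed_singleton.preimage hcont).mem_of_tendsto hb (.of_forall fun i => ha (φ i)),
    φ, hφ, hb⟩

theorem comap_nhds_le_nhdsSet [FirstCountableTopology Y] [T2Space Y] (hf : ProperAtPoint f y)
    (hcont : Continuous f) : comap f (𝓝 y) ≤ 𝓝ˢ (f ⁻¹' {y}) := by
  intro V hV
  by_contra hVf
  obtain ⟨a, ha, haV⟩ := exists_seq_forall_of_frequently
    (l := comap f (𝓝 y)) (p := fun g => g ∉ V) fun h =>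
      hVf (mem_of_superset h fun g hg => not_not.1 hg)
  have hfa : Tendsto (f ∘ a) atTop (𝓝 y) := tendsto_comap_iff.1 ha
  obtain ⟨b, φ, hφ, hb⟩ := hf a hfa
  have hfb : f b = y :=
    tendsto_nhds_unique ((hcont.tendsto b).comp hb) (hfa.comp hφ.tendsto_atTop)
  obtain ⟨i, hi⟩ := (hb.eventually (mem_nhdsSet_iff_forall.1 hV b hfb)).exists
  exact haV (φ i) hi

end ProperAtPoint

section IsotropyGroup

open Set

theorem SliceChart.exists_isAdaptedTo {A B E : Type*} [NormedAddCommGroup A] [NormedSpace ℝ A]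
    [NormedAddCommGroup B] [NormedSpace ℝ B] [NormedAddCommGroup E] [NormedSpace ℝ E] {G : Type*}
    [TopologicalSpace G] [ChartedSpace E G] {K : Type*} [TopologicalSpace K] {ι : K → G} {π : G → B}
    (hι : Topology.IsEmbedding ι) (σ : K → SliceChart A E ι π) (hσ : ∀ h, ι h ∈ (σ h).source)
    (h : K) :
    letI := SliceChart.chartedSpace hι σ hσ
    ∃ φ : PartialDiffeomorph 𝓘(ℝ, A) 𝓘(ℝ, A) K A ∞, (σ h).IsAdaptedTo φ ∧ h ∈ φ.source := by
  let _ := SliceChart.chartedSpace hι σ hσ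
  have := SliceChart.isManifold hι σ hσ
  exact ⟨chartPartialDiffeomorph (chartAt A h) (IsManifold.chart_mem_maximalAtlas h),
    ⟨rfl, fun _ _ => rfl⟩, mem_chart_source A h⟩

theorem exists_isSubmersionOfComplement_euclideanSpace {E B G M : Type*} [NormedAddCommGroup E]
    [NormedSpace ℝ E] [FiniteDimensional ℝ E] [NormedAddCommGroup B] [NormedSpace ℝ B]
    [TopologicalSpace G] [ChartedSpace E G] [Nonempty G] [TopologicalSpace M] [ChartedSpace B M]
    {s : G → M} (hs : Manifold.IsSubmersion 𝓘(ℝ, E) 𝓘(ℝ, B) ∞ s) :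
    ∃ k : ℕ, Manifold.IsSubmersionOfComplement (EuclideanSpace ℝ (Fin k)) 𝓘(ℝ, E) 𝓘(ℝ, B) ∞ s := by
  obtain ⟨F, _, _, hF⟩ := hs
  have : FiniteDimensional ℝ (B × F) :=
    (hF (Classical.arbitrary G)).equiv.toLinearEquiv.finiteDimensional
  have : FiniteDimensional ℝ F :=
    Module.Finite.of_surjective (LinearMap.snd ℝ B F) LinearMap.snd_surjective
  exact ⟨Module.finrank ℝ F, hF.trans_F (ContinuousLinearEquiv.ofFinrankEq (by simp))⟩

namespace LieGroupoid

variable {n m : ℕ} {M : Type*} [TopologicalSpace M] [ChartedSpace (EuclideanSpace ℝ (Fin n)) M]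
  {G : Type*} [TopologicalSpace G] [ChartedSpace (EuclideanSpace ℝ (Fin m)) G]
  {𝒢 : LieGroupoid n m M G} {x : M}

theorem IsFixedPoint.target_eq (hfix : 𝒢.IsFixedPoint x) {g : G} (hg : 𝒢.source g = x) :
    𝒢.target g = x := by
  have hmem : 𝒢.target g ∈ 𝒢.orbit x := ⟨g, hg, rfl⟩
  rwa [show 𝒢.orbit x = {x} from hfix] at hmem

theorem IsFixedPoint.mem_range_isotropyIncl (hfix : 𝒢.IsFixedPoint x) {g : G} :
    g ∈ range (𝒢.isotropyIncl x) ↔ 𝒢.source g = x :=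
  ⟨by rintro ⟨h, rfl⟩; exact h.2.1, fun hg => ⟨⟨g, hg, hfix.target_eq hg⟩, rfl⟩⟩

theorem source_isotropyIncl (h : 𝒢.Isotropy x) : 𝒢.source (𝒢.isotropyIncl x h) = x := h.2.1

theorem target_isotropyIncl (h : 𝒢.Isotropy x) : 𝒢.target (𝒢.isotropyIncl x h) = x := h.2.2

theorem unit_source_isotropyIncl (h : 𝒢.Isotropy x) :
    𝒢.unit (𝒢.source (𝒢.isotropyIncl x h)) = 𝒢.isotropyIncl x 1 := by
  rw [source_isotropyIncl]
  rfl

theorem isEmbedding_isotropyIncl : Topology.IsEmbedding (𝒢.isotropyIncl x) :=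
  Topology.IsEmbedding.subtypeVal

theorem continuous_source : Continuous 𝒢.source := 𝒢.source_submersion.contMDiff.continuous

theorem continuous_target : Continuous 𝒢.target := 𝒢.target_submersion.contMDiff.continuous

theorem continuous_anchor : Continuous 𝒢.anchor := 𝒢.continuous_target.prodMk 𝒢.continuous_source

theorem preimage_anchor_singleton : 𝒢.anchor ⁻¹' {(x, x)} = range (𝒢.isotropyIncl x) := by
  ext g
  constructor
  · intro hg
    exact ⟨⟨g, congrArg Prod.snd hg, congrArg Prod.fst hg⟩, rfl⟩
  · rintro ⟨h, rfl⟩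
    exact Prod.ext h.2.2 h.2.1

theorem IsProperAt.compactSpace_isotropy [T1Space M] [T2Space G] [SecondCountableTopology G]
    (hproper : 𝒢.IsProperAt x) : CompactSpace (𝒢.Isotropy x) := by
  have : LocallyCompactSpace G := ChartedSpace.locallyCompactSpace (EuclideanSpace ℝ (Fin m)) G
  have := Manifold.metrizableSpace (𝓡 m) G
  have hcompact := ProperAtPoint.isCompact_preimage_singleton hproper 𝒢.continuous_anchor
  rw [preimage_anchor_singleton, ← image_univ] at hcompact
  exact isCompact_univ_iff.1 (isEmbedding_isotropyIncl.isCompact_iff.2 hcompact)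

variable [IsManifold (𝓡 m) ∞ G] {A : Type*} [NormedAddCommGroup A] [NormedSpace ℝ A]

theorem lieGroup_isotropy_of_sliceChart {B : Type*} [NormedAddCommGroup B] [NormedSpace ℝ B]
    {π : G → B} (σ : 𝒢.Isotropy x → SliceChart A (EuclideanSpace ℝ (Fin m)) (𝒢.isotropyIncl x) π)
    (hσ : ∀ h, 𝒢.isotropyIncl x h ∈ (σ h).source)
    (L : (A × B) ≃L[ℝ] EuclideanSpace ℝ (Fin m)) :
    letI := SliceChart.chartedSpace isEmbedding_isotropyIncl σ hσ
    LieGroup 𝓘(ℝ, A) ∞ (𝒢.Isotropy x) := by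
  let _ := SliceChart.chartedSpace isEmbedding_isotropyIncl σ hσ
  have hι : ContMDiff 𝓘(ℝ, A) (𝓡 m) ∞ (𝒢.isotropyIncl x) :=
    (SliceChart.isImmersion isEmbedding_isotropyIncl σ hσ L).contMDiff
  refine { SliceChart.isManifold isEmbedding_isotropyIncl σ hσ with
    contMDiff_mul := fun p => SliceChart.contMDiffAt_of_comp isEmbedding_isotropyIncl σ hσ ?_
    contMDiff_inv := fun p => SliceChart.contMDiffAt_of_comp isEmbedding_isotropyIncl σ hσ
      (𝒢.inv_smooth.comp hι).contMDiffAt }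
  have hcomposable : ∀ q : 𝒢.Isotropy x × 𝒢.Isotropy x,
      𝒢.source (𝒢.isotropyIncl x q.1) = 𝒢.target (𝒢.isotropyIncl x q.2) :=
    fun q => q.1.2.1.trans q.2.2.2.symm
  obtain ⟨O, f, hO, hpO, hf, hfmul⟩ := 𝒢.mul_smooth (_, _) (hcomposable p)
  have hιι : ContMDiff (𝓘(ℝ, A).prod 𝓘(ℝ, A)) ((𝓡 m).prod (𝓡 m)) ∞
      (Prod.map (𝒢.isotropyIncl x) (𝒢.isotropyIncl x)) := hι.prodMap hι
  refine ((hf.contMDiffAt (hO.mem_nhds hpO)).comp p hιι.contMDiffAt).congr_of_eventuallyEq ?_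
  filter_upwards [(hO.preimage hιι.continuous).mem_nhds hpO] with q hq
  exact (hfmul _ hq (hcomposable q)).symm

variable [IsManifold (𝓡 n) ∞ M]
  {c : PartialDiffeomorph (𝓡 n) (𝓡 n) M (EuclideanSpace ℝ (Fin n)) ∞}

theorem IsFixedPoint.exists_sliceChart (hfix : 𝒢.IsFixedPoint x)
    (hs : Manifold.IsSubmersionOfComplement A (𝓡 m) (𝓡 n) ∞ 𝒢.source) (hxc : x ∈ c.source)
    (hcx : c x = 0) (h : 𝒢.Isotropy x) :
    ∃ σ : SliceChart A (EuclideanSpace ℝ (Fin m)) (𝒢.isotropyIncl x) (fun g => c (𝒢.source g)),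
      𝒢.isotropyIncl x h ∈ σ.source := by
  obtain ⟨e, he, hec⟩ := exists_partialDiffeomorph_snd_eq_of_isSubmersion hs c
    (g₀ := 𝒢.isotropyIncl x h) (by rwa [source_isotropyIncl])
  refine ⟨⟨e, fun g hg => (hec g hg).2, fun g hg => ?_⟩, he⟩
  rw [hfix.mem_range_isotropyIncl, ← hcx]
  exact ⟨congrArg c, c.injOn (hec g hg).1 hxc⟩

theorem IsFixedPoint.exists_lieGroup_isotropy (hfix : 𝒢.IsFixedPoint x) (hxc : x ∈ c.source)
    (hcx : c x = 0) :
    ∃ (k : ℕ) (_ : ChartedSpace (EuclideanSpace ℝ (Fin k)) (𝒢.Isotropy x)),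
      LieGroup (𝓡 k) ∞ (𝒢.Isotropy x) ∧
      Manifold.IsSmoothEmbedding (𝓡 k) (𝓡 m) ∞ (𝒢.isotropyIncl x) ∧
      ∀ h : 𝒢.Isotropy x,
        ∃ (σ : SliceChart (EuclideanSpace ℝ (Fin k)) (EuclideanSpace ℝ (Fin m)) (𝒢.isotropyIncl x)
            fun g => c (𝒢.source g))
          (φ : PartialDiffeomorph (𝓡 k) (𝓡 k) (𝒢.Isotropy x) (EuclideanSpace ℝ (Fin k)) ∞),
          σ.IsAdaptedTo φ ∧ h ∈ φ.source := by
  have : Nonempty G := ⟨𝒢.unit x⟩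
  obtain ⟨k, hs⟩ := exists_isSubmersionOfComplement_euclideanSpace 𝒢.source_submersion
  choose σ hσ using fun h => hfix.exists_sliceChart hs hxc hcx h
  let L : (EuclideanSpace ℝ (Fin k) × EuclideanSpace ℝ (Fin n)) ≃L[ℝ] EuclideanSpace ℝ (Fin m) :=
    (ContinuousLinearEquiv.prodComm ℝ _ _).trans (hs (𝒢.unit x)).equiv.symm
  let _ := SliceChart.chartedSpace isEmbedding_isotropyIncl σ hσ
  exact ⟨k, inferInstance, lieGroup_isotropy_of_sliceChart σ hσ L,
    ⟨(SliceChart.isImmersion isEmbedding_isotropyIncl σ hσ L).isImmersion,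
      isEmbedding_isotropyIncl⟩,
    fun h => ⟨σ h, SliceChart.exists_isAdaptedTo isEmbedding_isotropyIncl σ hσ h⟩⟩

end LieGroupoid

end IsotropyGroup

section TubularCharts

open Filter Set

namespace LieGroupoid

variable {n m : ℕ} {M : Type*} [TopologicalSpace M] [ChartedSpace (EuclideanSpace ℝ (Fin n)) M]
  {G : Type*} [TopologicalSpace G] [ChartedSpace (EuclideanSpace ℝ (Fin m)) G]
  {𝒢 : LieGroupoid n m M G} {x : M}
  {A : Type*} [NormedAddCommGroup A] [NormedSpace ℝ A] [ChartedSpace A (𝒢.Isotropy x)]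

/-- A trivialisation `Ψ` of the source map, read in a chart `c` of `M`, on a neighbourhood of the
isotropy group `G_x` in `G`: it extends the identification of `G_x` with `G_x × {0}` and maps units
into `{1} × ℝⁿ`. -/
structure IsTubularChart (c : PartialDiffeomorph (𝓡 n) (𝓡 n) M (EuclideanSpace ℝ (Fin n)) ∞)
    (Ψ : PartialDiffeomorph (𝓡 m) (𝓘(ℝ, A).prod (𝓡 n)) G
      (𝒢.Isotropy x × EuclideanSpace ℝ (Fin n)) ∞) : Prop where
  isotropyIncl_mem : ∀ h, 𝒢.isotropyIncl x h ∈ Ψ.source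
  apply_isotropyIncl : ∀ h, Ψ (𝒢.isotropyIncl x h) = (h, 0)
  source_mem : ∀ g ∈ Ψ.source, 𝒢.source g ∈ c.source
  target_mem : ∀ g ∈ Ψ.source, 𝒢.target g ∈ c.source
  snd_eq : ∀ g ∈ Ψ.source, (Ψ g).2 = c (𝒢.source g)
  fst_unit : ∀ y, 𝒢.unit y ∈ Ψ.source → (Ψ (𝒢.unit y)).1 = 1

variable {c : PartialDiffeomorph (𝓡 n) (𝓡 n) M (EuclideanSpace ℝ (Fin n)) ∞}
  {Ψ : PartialDiffeomorph (𝓡 m) (𝓘(ℝ, A).prod (𝓡 n)) G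
    (𝒢.Isotropy x × EuclideanSpace ℝ (Fin n)) ∞}

section Existence

variable [T2Space G] [SecondCountableTopology G] [IsManifold (𝓡 m) ∞ G]
  [LieGroup 𝓘(ℝ, A) ∞ (𝒢.Isotropy x)] [CompactSpace (𝒢.Isotropy x)]

theorem exists_isRetractionOn_map_unit_eq_one {π : G → EuclideanSpace ℝ (Fin n)}
    (hadapted : ∀ h : 𝒢.Isotropy x,
      ∃ (σ : SliceChart A (EuclideanSpace ℝ (Fin m)) (𝒢.isotropyIncl x) π)
        (φ : PartialDiffeomorph 𝓘(ℝ, A) 𝓘(ℝ, A) (𝒢.Isotropy x) A ∞),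
        σ.IsAdaptedTo φ ∧ h ∈ φ.source) :
    ∃ (r : G → 𝒢.Isotropy x) (V : Set G),
      IsRetractionOn A (EuclideanSpace ℝ (Fin m)) (𝒢.isotropyIncl x) r V ∧
      (∀ h, 𝒢.isotropyIncl x h ∈ V) ∧ ∀ y, r (𝒢.unit y) = 1 := by
  have : LocallyCompactSpace G := ChartedSpace.locallyCompactSpace (EuclideanSpace ℝ (Fin m)) G
  have : T2Space (𝒢.Isotropy x) := isEmbedding_isotropyIncl.t2Space
  obtain ⟨r, V, hr, hV⟩ := IsRetractionOn.exists_of_compactSpace (A := A)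
    (E := EuclideanSpace ℝ (Fin m)) (isEmbedding_isotropyIncl (𝒢 := 𝒢) (x := x)).continuous
    fun h => by
      obtain ⟨σ, φ, hσ, hh⟩ := hadapted h
      exact ⟨_, _, hσ.isRetractionOn, hσ.mem_isRetractionOn hh⟩
  refine ⟨_, _, hr.inv_comp_mul (e := fun g => 𝒢.unit (𝒢.source g))
    (𝒢.unit_smooth.comp 𝒢.source_submersion.contMDiff) unit_source_isotropyIncl,
    fun h => ⟨hV h, ?_⟩, fun y => ?_⟩
  · rw [mem_preimage, unit_source_isotropyIncl]
    exact hV 1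
  · rw [𝒢.source_unit, inv_mul_cancel]

theorem exists_isTubularChart [CompleteSpace A] (hxc : x ∈ c.source) (hcx : c x = 0)
    (hadapted : ∀ h : 𝒢.Isotropy x,
      ∃ (σ : SliceChart A (EuclideanSpace ℝ (Fin m)) (𝒢.isotropyIncl x) fun g => c (𝒢.source g))
        (φ : PartialDiffeomorph 𝓘(ℝ, A) 𝓘(ℝ, A) (𝒢.Isotropy x) A ∞),
        σ.IsAdaptedTo φ ∧ h ∈ φ.source) :
    ∃ Ψ : PartialDiffeomorph (𝓡 m) (𝓘(ℝ, A).prod (𝓡 n)) G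
      (𝒢.Isotropy x × EuclideanSpace ℝ (Fin n)) ∞, IsTubularChart c Ψ := by
  obtain ⟨r, V, hr, hV, hr1⟩ := exists_isRetractionOn_map_unit_eq_one hadapted
  have : Nonempty G := ⟨𝒢.unit x⟩
  let f : G → 𝒢.Isotropy x × EuclideanSpace ℝ (Fin n) := fun g => (r g, c (𝒢.source g))
  have hfι : ∀ h, f (𝒢.isotropyIncl x h) = (h, 0) := fun h =>
    Prod.ext (hr.apply_eq h (hV h)) ((congrArg c (source_isotropyIncl h)).trans hcx)
  have hlocal : ∀ g ∈ range (𝒢.isotropyIncl x),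
      IsLocalDiffeomorphAt (𝓡 m) (𝓘(ℝ, A).prod (𝓡 n)) ∞ f g := by
    rintro _ ⟨h, rfl⟩
    obtain ⟨σ, φ, hσ, hh⟩ := hadapted h
    exact hσ.isLocalDiffeomorphAt_prodMk hh hr (hV h)
  have hinj : InjOn f (range (𝒢.isotropyIncl x)) := by
    rintro _ ⟨h, rfl⟩ _ ⟨h', rfl⟩ heq
    rw [hfι, hfι] at heq
    exact congrArg (𝒢.isotropyIncl x) (congrArg Prod.fst heq)
  have : T2Space (𝒢.Isotropy x) := isEmbedding_isotropyIncl.t2Space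
  obtain ⟨Φ, hΦ, hΦf⟩ := exists_partialDiffeomorph_of_isCompact
    (isCompact_range (isEmbedding_isotropyIncl (𝒢 := 𝒢) (x := x)).continuous) hlocal hinj
  refine ⟨restrictPartialDiffeomorph Φ (𝒢.source ⁻¹' c.source ∩ 𝒢.target ⁻¹' c.source)
    ((c.open_source.preimage 𝒢.continuous_source).inter
      (c.open_source.preimage 𝒢.continuous_target)), fun h => ⟨hΦ (mem_range_self h), ?_, ?_⟩,
    fun h => (congrFun hΦf _).trans (hfι h), fun g hg => hg.2.1, fun g hg => hg.2.2,
    fun g _ => congrArg Prod.snd (congrFun hΦf g),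
    fun y _ => (congrArg Prod.fst (congrFun hΦf _)).trans (hr1 y)⟩
  · rwa [mem_preimage, source_isotropyIncl]
  · rwa [mem_preimage, target_isotropyIncl]

end Existence

variable (c Ψ) in
/-- The target map read in the chart `c` of `M` and in the coordinates of `G` given by `Ψ`. -/
noncomputable def targetInChart (p : 𝒢.Isotropy x × EuclideanSpace ℝ (Fin n)) :
    EuclideanSpace ℝ (Fin n) :=
  c (𝒢.target (Ψ.symm p))

theorem targetInChart_apply {g : G} (hg : g ∈ Ψ.source) :
    targetInChart c Ψ (Ψ g) = c (𝒢.target g) :=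
  congrArg (fun g => c (𝒢.target g)) (Ψ.left_inv hg)

namespace IsTubularChart

theorem base_mem (hΨ : IsTubularChart c Ψ) : x ∈ c.source := by
  simpa only [source_isotropyIncl] using hΨ.source_mem _ (hΨ.isotropyIncl_mem 1)

theorem apply_base (hΨ : IsTubularChart c Ψ) : c x = 0 := by
  have hsnd := hΨ.snd_eq _ (hΨ.isotropyIncl_mem 1)
  rwa [hΨ.apply_isotropyIncl, source_isotropyIncl, eq_comm] at hsnd

theorem mk_zero_mem (hΨ : IsTubularChart c Ψ) (h : 𝒢.Isotropy x) : (h, 0) ∈ Ψ.target := by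
  rw [← hΨ.apply_isotropyIncl]
  exact Ψ.map_source (hΨ.isotropyIncl_mem h)

theorem symm_mk_zero (hΨ : IsTubularChart c Ψ) (h : 𝒢.Isotropy x) :
    Ψ.symm (h, 0) = 𝒢.isotropyIncl x h := by
  rw [← hΨ.apply_isotropyIncl]
  exact Ψ.left_inv (hΨ.isotropyIncl_mem h)

theorem source_symm (hΨ : IsTubularChart c Ψ) {p : 𝒢.Isotropy x × EuclideanSpace ℝ (Fin n)}
    (hp : p ∈ Ψ.target) : c (𝒢.source (Ψ.symm p)) = p.2 :=
  (hΨ.snd_eq _ (Ψ.map_target hp)).symm.trans (congrArg Prod.snd (Ψ.right_inv hp))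

theorem targetInChart_mk_zero (hΨ : IsTubularChart c Ψ) (h : 𝒢.Isotropy x) :
    targetInChart c Ψ (h, 0) = 0 := by
  rw [← hΨ.apply_isotropyIncl, targetInChart_apply (hΨ.isotropyIncl_mem h), target_isotropyIncl,
    hΨ.apply_base]

theorem contMDiffOn_targetInChart (hΨ : IsTubularChart c Ψ) :
    ContMDiffOn (𝓘(ℝ, A).prod (𝓡 n)) (𝓡 n) ∞ (targetInChart c Ψ) Ψ.target :=
  c.contMDiffOn_toFun.comp (𝒢.target_submersion.contMDiff.comp_contMDiffOn Ψ.contMDiffOn_invFun)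
    fun _ hp => hΨ.target_mem _ (Ψ.map_target hp)

theorem contMDiffAt_targetInChart (hΨ : IsTubularChart c Ψ) (h : 𝒢.Isotropy x) :
    ContMDiffAt (𝓘(ℝ, A).prod (𝓡 n)) (𝓡 n) ∞ (targetInChart c Ψ) (h, 0) :=
  hΨ.contMDiffOn_targetInChart.contMDiffAt (Ψ.open_target.mem_nhds (hΨ.mk_zero_mem h))

theorem eventually_targetInChart_one (hΨ : IsTubularChart c Ψ) :
    ∀ᶠ z in 𝓝 0, targetInChart c Ψ (1, z) = z := by
  have hsymm : c.symm 0 = x := by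
    rw [← hΨ.apply_base]
    exact c.left_inv hΨ.base_mem
  have h0 : (0 : EuclideanSpace ℝ (Fin n)) ∈ c.target := by
    rw [← hΨ.apply_base]
    exact c.map_source hΨ.base_mem
  have hopen : IsOpen (c.target ∩ c.symm ⁻¹' (𝒢.unit ⁻¹' Ψ.source)) :=
    c.contMDiffOn_invFun.continuousOn.isOpen_inter_preimage c.open_target
      (Ψ.open_source.preimage 𝒢.unit_smooth.continuous)
  have hmem : 0 ∈ c.target ∩ c.symm ⁻¹' (𝒢.unit ⁻¹' Ψ.source) := by
    refine ⟨h0, ?_⟩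
    rw [mem_preimage, hsymm]
    exact hΨ.isotropyIncl_mem 1
  filter_upwards [hopen.mem_nhds hmem] with z ⟨hz, hu⟩
  have hcz : c (c.symm z) = z := c.right_inv hz
  have hΨu : Ψ (𝒢.unit (c.symm z)) = (1, z) := by
    refine Prod.ext (hΨ.fst_unit _ hu) ?_
    rw [hΨ.snd_eq _ hu, 𝒢.source_unit, hcz]
  rw [← hΨu, targetInChart_apply hu, 𝒢.target_unit, hcz]

variable [LieGroup 𝓘(ℝ, A) ∞ (𝒢.Isotropy x)]

-- Inversion exchanges the source and the target, so this is the upper bound for `‖T‖` at `h⁻¹`.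
theorem exists_norm_snd_le_mul_norm_targetInChart (hΨ : IsTubularChart c Ψ) (h : 𝒢.Isotropy x) :
    ∃ L : ℝ, ∀ᶠ p in 𝓝 (h, (0 : EuclideanSpace ℝ (Fin n))), ‖p.2‖ ≤ L * ‖targetInChart c Ψ p‖ := by
  obtain ⟨L, hL⟩ := exists_norm_le_mul_norm_snd_of_contMDiffAt (hΨ.contMDiffAt_targetInChart h⁻¹)
    (.of_forall hΨ.targetInChart_mk_zero)
  have hinv : 𝒢.inv (Ψ.symm (h, 0)) = 𝒢.isotropyIncl x h⁻¹ := by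
    rw [hΨ.symm_mk_zero]
    rfl
  have hΨsymm : ContinuousAt Ψ.symm (h, 0) :=
    Ψ.contMDiffOn_invFun.continuousOn.continuousAt (Ψ.open_target.mem_nhds (hΨ.mk_zero_mem h))
  have hg : Tendsto (fun p => 𝒢.inv (Ψ.symm p)) (𝓝 (h, 0)) (𝓝 (𝒢.isotropyIncl x h⁻¹)) := by
    rw [← hinv]
    exact (𝒢.inv_smooth.continuous.tendsto _).comp hΨsymm
  have hΨinv : ContinuousAt Ψ (𝒢.isotropyIncl x h⁻¹) :=
    Ψ.contMDiffOn_toFun.continuousOn.continuousAt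
      (Ψ.open_source.mem_nhds (hΨ.isotropyIncl_mem h⁻¹))
  have hq : Tendsto (fun p => Ψ (𝒢.inv (Ψ.symm p))) (𝓝 (h, 0)) (𝓝 (h⁻¹, 0)) := by
    rw [← hΨ.apply_isotropyIncl h⁻¹]
    exact hΨinv.tendsto.comp hg
  refine ⟨L, ?_⟩
  filter_upwards [hq.eventually hL, Ψ.open_target.mem_nhds (hΨ.mk_zero_mem h),
    hg.eventually (Ψ.open_source.mem_nhds (hΨ.isotropyIncl_mem h⁻¹))] with p hp hpΨ hpinv
  rwa [targetInChart_apply hpinv, hΨ.snd_eq _ hpinv, 𝒢.target_inv, 𝒢.source_inv,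
    hΨ.source_symm hpΨ] at hp

theorem eventually_forall_norm_targetInChart_smul_le (hΨ : IsTubularChart c Ψ)
    (h : 𝒢.Isotropy x) :
    ∀ᶠ p in 𝓝 (h, (0 : EuclideanSpace ℝ (Fin n))), ∀ l ∈ Icc (0 : ℝ) 1,
      ‖targetInChart c Ψ (p.1, l • p.2)‖ ≤ ‖targetInChart c Ψ p‖ := by
  obtain ⟨L, hL⟩ := hΨ.exists_norm_snd_le_mul_norm_targetInChart h
  exact eventually_forall_norm_smul_snd_le_of_contMDiffAt (hΨ.contMDiffAt_targetInChart h)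
    (.of_forall hΨ.targetInChart_mk_zero) hL

end IsTubularChart

end LieGroupoid

end TubularCharts

section AdmissibleRadii

open Filter Set Metric

theorem exists_pos_forall_norm_lt_mem {E M : Type*} [NormedAddCommGroup E] [NormedSpace ℝ E]
    [TopologicalSpace M] [ChartedSpace E M] (c : PartialDiffeomorph 𝓘(ℝ, E) 𝓘(ℝ, E) M E ∞) {x : M}
    (hx : x ∈ c.source) (hcx : c x = 0) {O : Set M} (hO : O ∈ 𝓝 x) :
    ∃ ρ > 0, ∀ y ∈ c.source, ‖c y‖ < ρ → y ∈ O := by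
  have hsymm : c.symm 0 = x := by
    rw [← hcx]
    exact c.left_inv hx
  have h0 : (0 : E) ∈ c.target := by
    rw [← hcx]
    exact c.map_source hx
  have hcont : ContinuousAt c.symm 0 :=
    c.contMDiffOn_invFun.continuousOn.continuousAt (c.open_target.mem_nhds h0)
  obtain ⟨ρ, hρ, hball⟩ := eventually_nhds_iff_ball.1 (hcont.eventually_mem (hsymm ▸ hO))
  refine ⟨ρ, hρ, fun y hy hyρ => ?_⟩
  have hmem := hball (c y) (mem_ball_zero_iff.2 hyρ)
  rwa [show c.symm (c y) = y from c.left_inv hy] at hmem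

theorem eventually_forall_prodMk {K B : Type*} [TopologicalSpace K] [CompactSpace K]
    [TopologicalSpace B] {P : K × B → Prop} {b : B} (hP : ∀ k, ∀ᶠ p in 𝓝 (k, b), P p) :
    ∀ᶠ z in 𝓝 b, ∀ k, P (k, z) := by
  have hall := isCompact_univ.eventually_forall_of_forall_eventually (x₀ := b)
    (K := (univ : Set K)) (P := fun z k => P (k, z))
    fun k _ => (continuous_swap.tendsto' (b, k) (k, b) rfl).eventually (hP k)
  simpa only [mem_univ, true_implies] using hall

namespace LieGroupoid

variable {n m : ℕ} {M : Type*} [TopologicalSpace M] [ChartedSpace (EuclideanSpace ℝ (Fin n)) M]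
  {G : Type*} [TopologicalSpace G] [ChartedSpace (EuclideanSpace ℝ (Fin m)) G]
  {𝒢 : LieGroupoid n m M G} {x : M}
  {A : Type*} [NormedAddCommGroup A] [NormedSpace ℝ A] [ChartedSpace A (𝒢.Isotropy x)]

/-- A radius `R ≤ R₀` such that over the ball of radius `R` the coordinates `Ψ` are defined, the
target map stays in the ball of radius `R₀`, is the identity on the units, and has a norm which does
not decrease along rays. No arrow between points of the ball of radius `R₀` escapes the domain of
`Ψ`. -/
structure IsAdmissibleRadius (c : PartialDiffeomorph (𝓡 n) (𝓡 n) M (EuclideanSpace ℝ (Fin n)) ∞)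
    (Ψ : PartialDiffeomorph (𝓡 m) (𝓘(ℝ, A).prod (𝓡 n)) G
      (𝒢.Isotropy x × EuclideanSpace ℝ (Fin n)) ∞) (R₀ R : ℝ) : Prop where
  pos : 0 < R
  le : R ≤ R₀
  mem_target : ∀ z ∈ ball 0 R, ∀ h, (h, z) ∈ Ψ.target
  norm_smul_le : ∀ z ∈ ball 0 R, ∀ h, ∀ l ∈ Icc (0 : ℝ) 1,
    ‖targetInChart c Ψ (h, l • z)‖ ≤ ‖targetInChart c Ψ (h, z)‖
  norm_lt : ∀ z ∈ ball 0 R, ∀ h, ‖targetInChart c Ψ (h, z)‖ < R₀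
  targetInChart_one : ∀ z ∈ ball 0 R, targetInChart c Ψ (1, z) = z
  mem_source : ∀ g, 𝒢.source g ∈ c.source → 𝒢.target g ∈ c.source → ‖c (𝒢.source g)‖ < R₀ →
    ‖c (𝒢.target g)‖ < R₀ → g ∈ Ψ.source

variable {c : PartialDiffeomorph (𝓡 n) (𝓡 n) M (EuclideanSpace ℝ (Fin n)) ∞}
  {Ψ : PartialDiffeomorph (𝓡 m) (𝓘(ℝ, A).prod (𝓡 n)) G
    (𝒢.Isotropy x × EuclideanSpace ℝ (Fin n)) ∞}

theorem IsTubularChart.exists_pos_forall_mem_source [T2Space M] [FirstCountableTopology M]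
    (hΨ : IsTubularChart c Ψ) (hproper : 𝒢.IsProperAt x) :
    ∃ R₀ > 0, ∀ g, 𝒢.source g ∈ c.source → 𝒢.target g ∈ c.source → ‖c (𝒢.source g)‖ < R₀ →
      ‖c (𝒢.target g)‖ < R₀ → g ∈ Ψ.source := by
  have hnhds : Ψ.source ∈ comap 𝒢.anchor (𝓝 (x, x)) := by
    refine ProperAtPoint.comap_nhds_le_nhdsSet hproper 𝒢.continuous_anchor ?_
    rw [preimage_anchor_singleton, Ψ.open_source.mem_nhdsSet]
    exact range_subset_iff.2 hΨ.isotropyIncl_mem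
  obtain ⟨O, hO, hOΨ⟩ := hnhds
  obtain ⟨O₁, hO₁, O₂, hO₂, hO₁₂⟩ := mem_nhds_prod_iff.1 hO
  obtain ⟨R₀, hR₀, hmem⟩ :=
    exists_pos_forall_norm_lt_mem c hΨ.base_mem hΨ.apply_base (inter_mem hO₁ hO₂)
  exact ⟨R₀, hR₀, fun g hs ht hsR htR => hOΨ (hO₁₂ ⟨(hmem _ ht htR).1, (hmem _ hs hsR).2⟩)⟩

theorem IsTubularChart.exists_isAdmissibleRadius [T2Space M] [FirstCountableTopology M]
    [LieGroup 𝓘(ℝ, A) ∞ (𝒢.Isotropy x)] [CompactSpace (𝒢.Isotropy x)]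
    (hΨ : IsTubularChart c Ψ) (hproper : 𝒢.IsProperAt x) :
    ∃ R₀ R, IsAdmissibleRadius c Ψ R₀ R := by
  obtain ⟨R₀, hR₀, hsource⟩ := hΨ.exists_pos_forall_mem_source hproper
  have hlt : ∀ h, ∀ᶠ p in 𝓝 (h, (0 : EuclideanSpace ℝ (Fin n))), ‖targetInChart c Ψ p‖ < R₀ :=
    fun h => (hΨ.contMDiffAt_targetInChart h).continuousAt.norm.eventually_lt continuousAt_const
      (by rwa [hΨ.targetInChart_mk_zero, norm_zero])
  obtain ⟨R, hR, hball⟩ := eventually_nhds_iff_ball.1 <|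
    (eventually_forall_prodMk fun h => Ψ.open_target.mem_nhds (hΨ.mk_zero_mem h)).and <|
    (eventually_forall_prodMk hΨ.eventually_forall_norm_targetInChart_smul_le).and <|
    (eventually_forall_prodMk hlt).and hΨ.eventually_targetInChart_one
  have hmin : ball (0 : EuclideanSpace ℝ (Fin n)) (min R R₀) ⊆ ball 0 R :=
    ball_subset_ball (min_le_left _ _)
  exact ⟨R₀, min R R₀, lt_min hR hR₀, min_le_right _ _, fun z hz => (hball z (hmin hz)).1,
    fun z hz => (hball z (hmin hz)).2.1, fun z hz => (hball z (hmin hz)).2.2.1,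
    fun z hz => (hball z (hmin hz)).2.2.2, hsource⟩

end LieGroupoid

end AdmissibleRadii

section SaturatedNeighbourhoods

open Filter Set Metric TopologicalSpace

namespace LieGroupoid

variable {n m : ℕ} {M : Type*} [TopologicalSpace M] [ChartedSpace (EuclideanSpace ℝ (Fin n)) M]
  {G : Type*} [TopologicalSpace G] [ChartedSpace (EuclideanSpace ℝ (Fin m)) G]
  {𝒢 : LieGroupoid n m M G} {x : M}
  {A : Type*} [NormedAddCommGroup A] [NormedSpace ℝ A] [ChartedSpace A (𝒢.Isotropy x)]

/-- The points of the ball of radius `R` all of whose arrows, in the coordinates `Ψ`, have target of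
norm less than `ρ`. -/
def targetSublevel (c : PartialDiffeomorph (𝓡 n) (𝓡 n) M (EuclideanSpace ℝ (Fin n)) ∞)
    (Ψ : PartialDiffeomorph (𝓡 m) (𝓘(ℝ, A).prod (𝓡 n)) G
      (𝒢.Isotropy x × EuclideanSpace ℝ (Fin n)) ∞) (R ρ : ℝ) : Set (EuclideanSpace ℝ (Fin n)) :=
  {z ∈ ball 0 R | ∀ h, ‖targetInChart c Ψ (h, z)‖ < ρ}

/-- The open subset of `M` corresponding to an open set of coordinates in a chart `c`. -/
def chartPreimage (c : PartialDiffeomorph (𝓡 n) (𝓡 n) M (EuclideanSpace ℝ (Fin n)) ∞)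
    {S : Set (EuclideanSpace ℝ (Fin n))} (hS : IsOpen S) : Opens M :=
  ⟨c.source ∩ c ⁻¹' S, c.contMDiffOn_toFun.continuousOn.isOpen_inter_preimage c.open_source hS⟩

variable {c : PartialDiffeomorph (𝓡 n) (𝓡 n) M (EuclideanSpace ℝ (Fin n)) ∞}
  {Ψ : PartialDiffeomorph (𝓡 m) (𝓘(ℝ, A).prod (𝓡 n)) G
    (𝒢.Isotropy x × EuclideanSpace ℝ (Fin n)) ∞} {R₀ R ρ : ℝ}

namespace IsAdmissibleRadius

theorem mem_chart_target (hR : IsAdmissibleRadius c Ψ R₀ R) (hΨ : IsTubularChart c Ψ)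
    {z : EuclideanSpace ℝ (Fin n)} (hz : z ∈ ball 0 R) : z ∈ c.target := by
  have hmem : (1, z) ∈ Ψ.target := hR.mem_target z hz 1
  rw [← show c (𝒢.source (Ψ.symm (1, z))) = z from hΨ.source_symm hmem]
  exact c.map_source (hΨ.source_mem _ (Ψ.map_target hmem))

theorem isOpen_targetSublevel [CompactSpace (𝒢.Isotropy x)] (hR : IsAdmissibleRadius c Ψ R₀ R)
    (hΨ : IsTubularChart c Ψ) : IsOpen (targetSublevel c Ψ R ρ) := by
  refine isOpen_iff_mem_nhds.2 fun z hz => ?_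
  refine inter_mem (isOpen_ball.mem_nhds hz.1) (eventually_forall_prodMk
    (P := fun p => ‖targetInChart c Ψ p‖ < ρ) fun h => ?_)
  exact (hΨ.contMDiffOn_targetInChart.continuousOn.continuousAt
    (Ψ.open_target.mem_nhds (hR.mem_target z hz.1 h))).norm.eventually_lt continuousAt_const
    (hz.2 h)

theorem zero_mem_targetSublevel (hR : IsAdmissibleRadius c Ψ R₀ R) (hΨ : IsTubularChart c Ψ)
    (hρ : 0 < ρ) : 0 ∈ targetSublevel c Ψ R ρ :=
  ⟨mem_ball_self hR.pos, fun h => by rwa [hΨ.targetInChart_mk_zero, norm_zero]⟩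

theorem starConvex_targetSublevel (hR : IsAdmissibleRadius c Ψ R₀ R) :
    StarConvex ℝ 0 (targetSublevel c Ψ R ρ) := by
  refine starConvex_zero_iff.2 fun z hz l hl0 hl1 => ⟨?_, fun h => ?_⟩
  · exact starConvex_zero_iff.1 ((convex_ball 0 R).starConvex (mem_ball_self hR.pos)) hz.1 hl0 hl1
  · exact (hR.norm_smul_le z hz.1 h l ⟨hl0, hl1⟩).trans_lt (hz.2 h)

theorem norm_lt_of_mem_targetSublevel (hR : IsAdmissibleRadius c Ψ R₀ R)
    {z : EuclideanSpace ℝ (Fin n)} (hz : z ∈ targetSublevel c Ψ R ρ) : ‖z‖ < ρ := by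
  simpa only [hR.targetInChart_one z hz.1] using hz.2 1

-- An arrow issuing from the target of `g` is the quotient of two arrows issuing from its source.
theorem map_target_mem_targetSublevel (hR : IsAdmissibleRadius c Ψ R₀ R)
    (hΨ : IsTubularChart c Ψ) {g : G} (hs : 𝒢.source g ∈ c.source) (ht : 𝒢.target g ∈ c.source)
    (hsΩ : c (𝒢.source g) ∈ targetSublevel c Ψ R ρ) (htR : c (𝒢.target g) ∈ ball 0 R) :
    c (𝒢.target g) ∈ targetSublevel c Ψ R ρ := by
  refine ⟨htR, fun h => ?_⟩
  have hmem : (h, c (𝒢.target g)) ∈ Ψ.target := hR.mem_target _ htR h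
  let g₁ : G := Ψ.symm (h, c (𝒢.target g))
  have hg₁ : g₁ ∈ Ψ.source := Ψ.map_target hmem
  have hcomp : 𝒢.source g₁ = 𝒢.target g :=
    c.injOn (hΨ.source_mem g₁ hg₁) ht (hΨ.source_symm hmem)
  let g₂ : G := 𝒢.mul g₁ g hcomp
  have hs₂ : 𝒢.source g₂ = 𝒢.source g := 𝒢.source_mul _ _ _
  have ht₂ : 𝒢.target g₂ = 𝒢.target g₁ := 𝒢.target_mul _ _ _
  have hg₂ : g₂ ∈ Ψ.source := by
    refine hR.mem_source g₂ ?_ ?_ ?_ ?_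
    · rwa [hs₂]
    · rw [ht₂]
      exact hΨ.target_mem g₁ hg₁
    · rw [hs₂]
      exact (mem_ball_zero_iff.1 hsΩ.1).trans_le hR.le
    · rw [ht₂]
      exact hR.norm_lt _ htR h
  have hΨg₂ : Ψ g₂ = ((Ψ g₂).1, c (𝒢.source g)) :=
    Prod.ext rfl ((hΨ.snd_eq g₂ hg₂).trans (congrArg c hs₂))
  calc ‖targetInChart c Ψ (h, c (𝒢.target g))‖ = ‖c (𝒢.target g₂)‖ := by rw [ht₂]; rfl
    _ = ‖targetInChart c Ψ (Ψ g₂)‖ := by rw [targetInChart_apply hg₂]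
    _ < ρ := by
      rw [hΨg₂]
      exact hsΩ.2 _

theorem isSaturatedIn (hR : IsAdmissibleRadius c Ψ R₀ R) (hΨ : IsTubularChart c Ψ)
    (hΩ : IsOpen (targetSublevel c Ψ R ρ)) :
    𝒢.IsSaturatedIn (chartPreimage c hΩ : Set M)
      (chartPreimage c (isOpen_ball (x := 0) (ε := R))) :=
  ⟨fun _ hy => ⟨hy.1, hy.2.1⟩, fun _ hs ht =>
    ⟨ht.1, hR.map_target_mem_targetSublevel hΨ hs.1 ht.1 hs.2 ht.2⟩⟩

theorem mem_restrict_iff (hR : IsAdmissibleRadius c Ψ R₀ R) (hΨ : IsTubularChart c Ψ) (hρ : ρ ≤ R)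
    (hΩ : IsOpen (targetSublevel c Ψ R ρ)) {g : G} :
    g ∈ 𝒢.restrict (chartPreimage c hΩ) ↔
      g ∈ Ψ.source ∧ c (𝒢.source g) ∈ targetSublevel c Ψ R ρ := by
  constructor
  · rintro ⟨hs, ht⟩
    exact ⟨hR.mem_source g hs.1 ht.1 ((mem_ball_zero_iff.1 hs.2.1).trans_le hR.le)
      ((mem_ball_zero_iff.1 ht.2.1).trans_le hR.le), hs.2⟩
  · rintro ⟨hg, hsΩ⟩
    have htρ : ‖c (𝒢.target g)‖ < ρ := by
      rw [← targetInChart_apply hg, ← Prod.mk.eta (p := Ψ g), hΨ.snd_eq g hg]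
      exact hsΩ.2 _
    have ht : c (𝒢.target g) ∈ ball 0 R := mem_ball_zero_iff.2 (htρ.trans_le hρ)
    exact ⟨⟨hΨ.source_mem g hg, hsΩ⟩, hΨ.target_mem g hg, hR.map_target_mem_targetSublevel hΨ
      (hΨ.source_mem g hg) (hΨ.target_mem g hg) hsΩ ht⟩

theorem bijOn_chartPreimage (hR : IsAdmissibleRadius c Ψ R₀ R) (hΨ : IsTubularChart c Ψ)
    (hΩ : IsOpen (targetSublevel c Ψ R ρ)) :
    BijOn c (chartPreimage c hΩ) (targetSublevel c Ψ R ρ) := by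
  refine ⟨fun y hy => hy.2, c.injOn.mono fun y hy => hy.1, fun z hz => ?_⟩
  have hzc := hR.mem_chart_target hΨ hz.1
  have hcz : c (c.symm z) = z := c.right_inv hzc
  exact ⟨c.symm z, ⟨c.map_target hzc, by rwa [mem_preimage, hcz]⟩, hcz⟩

theorem bijOn_restrict (hR : IsAdmissibleRadius c Ψ R₀ R) (hΨ : IsTubularChart c Ψ) (hρ : ρ ≤ R)
    (hΩ : IsOpen (targetSublevel c Ψ R ρ)) :
    BijOn Ψ (𝒢.restrict (chartPreimage c hΩ)) (univ ×ˢ targetSublevel c Ψ R ρ) := by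
  refine ⟨fun g hg => ⟨mem_univ _, ?_⟩,
    Ψ.injOn.mono fun g hg => ((hR.mem_restrict_iff hΨ hρ hΩ).1 hg).1, ?_⟩
  · obtain ⟨hgΨ, hgΩ⟩ := (hR.mem_restrict_iff hΨ hρ hΩ).1 hg
    rwa [hΨ.snd_eq g hgΨ]
  · rintro ⟨h, z⟩ ⟨-, hz⟩
    have hmem : (h, z) ∈ Ψ.target := hR.mem_target z hz.1 h
    refine ⟨Ψ.symm (h, z), (hR.mem_restrict_iff hΨ hρ hΩ).2 ⟨Ψ.map_target hmem, ?_⟩,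
      Ψ.right_inv hmem⟩
    rwa [hΨ.source_symm hmem]

variable [IsManifold (𝓡 n) ∞ M] [IsManifold (𝓡 m) ∞ G]

theorem exists_trivialization (hR : IsAdmissibleRadius c Ψ R₀ R) (hΨ : IsTubularChart c Ψ)
    (hρ : 0 < ρ) (hρR : ρ ≤ R) (hΩ : IsOpen (targetSublevel c Ψ R ρ))
    (hx : x ∈ chartPreimage c hΩ) :
    ∃ (ψ : Diffeomorph (𝓡 n) (𝓡 n) (chartPreimage c hΩ) (EuclideanSpace ℝ (Fin n)) ∞)
      (Φ : Diffeomorph (𝓡 m) (𝓘(ℝ, A).prod (𝓡 n)) (𝒢.restrict (chartPreimage c hΩ))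
        (𝒢.Isotropy x × EuclideanSpace ℝ (Fin n)) ∞),
      (∀ g : 𝒢.Isotropy x, Φ (𝒢.isotropyToRestrict _ hx g) = (g, 0)) ∧
      (∀ g, (Φ g).2 = ψ (𝒢.restrictSource _ g)) ∧
      ∀ y, Φ (𝒢.restrictUnit _ y) = (1, ψ y) := by
  obtain ⟨θ, hθ0, hθ, hθbij⟩ := exists_bijOn_univ_of_starConvex hΩ
    (hR.zero_mem_targetSublevel hΨ hρ) hR.starConvex_targetSublevel
  have hrestrict : ∀ g : 𝒢.restrict (chartPreimage c hΩ), g.1 ∈ Ψ.source :=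
    fun g => ((hR.mem_restrict_iff hΨ hρR hΩ).1 g.2).1
  obtain ⟨ψ, hψ⟩ := exists_diffeomorph_of_bijOn (f := θ ∘ c) (chartPreimage c hΩ)
    (fun y hy => (c.isLocalDiffeomorphAt _ _ _ hy.1).comp _ _ (hθ _ hy.2))
    (hθbij.comp (hR.bijOn_chartPreimage hΨ hΩ))
  have hprodbij : BijOn (Prod.map id θ) ((univ : Set (𝒢.Isotropy x)) ×ˢ targetSublevel c Ψ R ρ)
      (univ ×ˢ univ) := (bijOn_id univ).prodMap hθbij
  rw [univ_prod_univ] at hprodbij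
  obtain ⟨Φ, hΦ⟩ := exists_diffeomorph_of_bijOn (f := Prod.map id θ ∘ Ψ)
    (J := 𝓘(ℝ, A).prod (𝓡 n)) (𝒢.restrict (chartPreimage c hΩ))
    (fun g hg => (Ψ.isLocalDiffeomorphAt _ _ _ (hrestrict ⟨g, hg⟩)).comp _ _
      (isLocalDiffeomorphAt_prodMap (isLocalDiffeomorphAt_id _)
        (hθ _ ((hR.bijOn_restrict hΨ hρR hΩ).mapsTo hg).2)))
    (hprodbij.comp (hR.bijOn_restrict hΨ hρR hΩ))
  have hΦsnd : ∀ g, (Φ g).2 = ψ (𝒢.restrictSource _ g) := fun g => by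
    rw [hΦ, hψ]
    exact congrArg θ (hΨ.snd_eq _ (hrestrict g))
  refine ⟨ψ, Φ, fun g => ?_, hΦsnd, fun y => Prod.ext ?_ ?_⟩
  · rw [hΦ]
    exact (congrArg (Prod.map id θ) (hΨ.apply_isotropyIncl g)).trans (congrArg (Prod.mk g) hθ0)
  · rw [hΦ]
    exact hΨ.fst_unit y (hrestrict (𝒢.restrictUnit _ y))
  · rw [hΦsnd]
    exact congrArg ψ (Subtype.ext (𝒢.source_unit y))

theorem exists_saturated_trivialization [CompactSpace (𝒢.Isotropy x)]
    (hR : IsAdmissibleRadius c Ψ R₀ R)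
    (hΨ : IsTubularChart c Ψ) {W' : Opens M} (hW' : x ∈ W') :
    ∃ (U : Opens M) (hx : x ∈ U), U ≤ W' ∧
      𝒢.IsSaturatedIn (U : Set M) (chartPreimage c (isOpen_ball (x := 0) (ε := R)) : Set M) ∧
      ∃ (ψ : Diffeomorph (𝓡 n) (𝓡 n) U (EuclideanSpace ℝ (Fin n)) ∞)
        (Φ : Diffeomorph (𝓡 m) (𝓘(ℝ, A).prod (𝓡 n)) (𝒢.restrict U)
          (𝒢.Isotropy x × EuclideanSpace ℝ (Fin n)) ∞),
        (∀ g : 𝒢.Isotropy x, Φ (𝒢.isotropyToRestrict U hx g) = (g, 0)) ∧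
        (∀ g : 𝒢.restrict U, (Φ g).2 = ψ (𝒢.restrictSource U g)) ∧
        ∀ y : U, Φ (𝒢.restrictUnit U y) = (1, ψ y) := by
  obtain ⟨ρ, hρ, hρW'⟩ :=
    exists_pos_forall_norm_lt_mem c hΨ.base_mem hΨ.apply_base (W'.isOpen.mem_nhds hW')
  have hΩ : IsOpen (targetSublevel c Ψ R (min ρ R)) := hR.isOpen_targetSublevel hΨ
  have hmin : 0 < min ρ R := lt_min hρ hR.pos
  have hx : x ∈ chartPreimage c hΩ := by
    refine ⟨hΨ.base_mem, ?_⟩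
    rw [mem_preimage, hΨ.apply_base]
    exact hR.zero_mem_targetSublevel hΨ hmin
  exact ⟨chartPreimage c hΩ, hx, fun y hy => hρW' y hy.1
    ((hR.norm_lt_of_mem_targetSublevel hy.2).trans_le (min_le_left _ _)),
    hR.isSaturatedIn hΨ hΩ, hR.exists_trivialization hΨ hmin (min_le_right _ _) hΩ hx⟩

end IsAdmissibleRadius

end LieGroupoid

end SaturatedNeighbourhoods

/-- The isotropy group `G_x` has a structure of Lie group for which it is an embedded submanifold of
`G` (by embeddedness, this smooth structure is unique), and `x` has arbitrarily small open
neighbourhoods `U`, saturated in the restriction of `G` to a fixed neighbourhood `W` of `x`, with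
`U ≅ ℝⁿ` and `G_U ≅ G_x × ℝⁿ` as asserted. -/
theorem mainTheorem9 {n m : ℕ}
    {M : Type*} [TopologicalSpace M] [T2Space M] [SecondCountableTopology M]
    [ChartedSpace (EuclideanSpace ℝ (Fin n)) M] [IsManifold (𝓡 n) ∞ M]
    {G : Type*} [TopologicalSpace G] [T2Space G] [SecondCountableTopology G]
    [ChartedSpace (EuclideanSpace ℝ (Fin m)) G] [IsManifold (𝓡 m) ∞ G]
    (𝒢 : LieGroupoid n m M G) (x : M)
    (hfix : 𝒢.IsFixedPoint x) (hproper : 𝒢.IsProperAt x) :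
    ∃ (k : ℕ) (_ : ChartedSpace (EuclideanSpace ℝ (Fin k)) (𝒢.Isotropy x)),
      LieGroup (𝓡 k) ∞ (𝒢.Isotropy x) ∧
      Manifold.IsSmoothEmbedding (𝓡 k) (𝓡 m) ∞ (𝒢.isotropyIncl x) ∧
      ∃ W : TopologicalSpace.Opens M, x ∈ W ∧
        ∀ W' : TopologicalSpace.Opens M, x ∈ W' →
          ∃ (U : TopologicalSpace.Opens M) (hx : x ∈ U), U ≤ W' ∧
            𝒢.IsSaturatedIn (U : Set M) (W : Set M) ∧
            ∃ (ψ : Diffeomorph (𝓡 n) (𝓡 n) U (EuclideanSpace ℝ (Fin n)) ∞)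
              (Φ : Diffeomorph (𝓡 m) ((𝓡 k).prod (𝓡 n)) (𝒢.restrict U)
                (𝒢.Isotropy x × EuclideanSpace ℝ (Fin n)) ∞),
              (∀ g : 𝒢.Isotropy x, Φ (𝒢.isotropyToRestrict U hx g) = (g, 0)) ∧
              (∀ g : 𝒢.restrict U, (Φ g).2 = ψ (𝒢.restrictSource U g)) ∧
              (∀ y : U, Φ (𝒢.restrictUnit U y) = (1, ψ y)) := by
  have := hproper.compactSpace_isotropy
  obtain ⟨c, hxc, hcx⟩ := exists_partialDiffeomorph_apply_eq_zero (E := EuclideanSpace ℝ (Fin n)) x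
  obtain ⟨k, _, hLie, hemb, hadapted⟩ := hfix.exists_lieGroup_isotropy hxc hcx
  obtain ⟨Ψ, hΨ⟩ := LieGroupoid.exists_isTubularChart hxc hcx hadapted
  obtain ⟨R₀, R, hR⟩ := hΨ.exists_isAdmissibleRadius hproper
  refine ⟨k, inferInstance, hLie, hemb,
    LieGroupoid.chartPreimage c (Metric.isOpen_ball (x := 0) (ε := R)), ⟨hxc, ?_⟩,
    fun W' hW' => hR.exists_saturated_trivialization hΨ hW'⟩
  rw [Set.mem_preimage, hcx]
  exact Metric.mem_ball_self hR.pos
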